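/- Let $A$ be an $n\times n$ complex matrix with eigenvalues $\lambda_1(A),\dots,\lambda_n(A)$ (with algebraic multiplicity), and let $c=(c_1,\dots,c_n)\in\mathbb{R}^n$. For real $\theta$ put $H_\theta(A)=\tfrac12(e^{i\theta}A+e^{-i\theta}A^*)$, and list the eigenvalues of this Hermitian matrix as $\lambda_1(H_\theta(A))\ge\dots\ge\lambda_n(H_\theta(A))$. The weighted numerical range of $A$ is $$W(A;c)=\bigcap_{\theta\in\mathbb{R}}\Big\{v\in\mathbb{C} : \operatorname{Re}(e^{i\theta}v)\le \sum_{j=1}^n c_j\lambda_j(H_\theta(A))\Big\},$$ and for $1\le k\le n$ the rank-$k$ numerical range of $A$ is $$\Lambda_k(A)=\{\lambda\in\mathbb{C} : PAP=\lambda P\text{ for some orthogonal projection }P\text{ of rank }k\}.$$ Let $c_{i_1},\dots,c_{i_r}$ be the nonzero entries of $c$. A $c$-value of $A$ is a number $c_{i_1}\lambda_{j_1}(A)+\dots+c_{i_r}\lambda_{j_r}(A)$ with distinct indices $j_1,\dots,j_r\in\{1,\dots,n\}$. The $c$-polynomial $p(A;c)$ is the monic polynomial $\prod_{\ell}\big(t-\ell(\lambda_1(A),\dots,\lambda_n(A))\big)$,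 where $\ell$ runs over the distinct linear forms among $c_{i_1}x_{j_1}+\dots+c_{i_r}x_{j_r}$ ($j_1,\dots,j_r$ distinct), each taken once. Its degree is denoted $\deg(A;c)$, and the multiplicity of a $c$-value is its multiplicity as a root of $p(A;c)$. Let $\alpha\in\mathbb{C}$. 1. If the boundary $\partial W(A;c)$ contains $2\deg(A;c)+1$ distinct points of a circle of positive radius centred at $\alpha$, then $\alpha$ is a $c$-value of $A$ of multiplicity greater than $1$. 2. Consequently, if $1\le k\le n$ and the boundary $\partial\Lambda_k(A)$ contains a non-degenerate arc of a circle of positive radius centred at $\alpha$, then $\alpha$ is an eigenvalue of $A$ of algebraic multiplicity greater than $1$. -/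

import Mathlib

namespace WeightedNumericalRange

noncomputable section

/-- The Hermitian matrix `H_θ(A) = (e^{iθ} A + e^{-iθ} A^*) / 2`. -/
def rotatedRealPart {n : ℕ} (A : Matrix (Fin n) (Fin n) ℂ) (θ : ℝ) :
    Matrix (Fin n) (Fin n) ℂ :=
  (1 / 2 : ℂ) • (Complex.exp (θ * Complex.I) • A
    + Complex.exp (-(θ * Complex.I)) • A.conjTranspose)

theorem rotatedRealPart_isHermitian {n : ℕ} (A : Matrix (Fin n) (Fin n) ℂ) (θ : ℝ) :
    (rotatedRealPart A θ).IsHermitian := by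
  unfold rotatedRealPart Matrix.IsHermitian
  simp only [Matrix.conjTranspose_smul, Matrix.conjTranspose_add,
    Matrix.conjTranspose_conjTranspose, Complex.star_def, ← Complex.exp_conj, map_neg, map_mul,
    Complex.conj_I, Complex.conj_ofReal, mul_neg, neg_neg, map_div₀, map_one, map_ofNat]
  rw [add_comm]

/-- The eigenvalues of a Hermitian matrix in decreasing order, `λ_1 ≥ λ_2 ≥ ⋯ ≥ λ_n`
(the index `i : Fin n` stands for the position `i + 1`). -/
def sortedEigenvalue {n : ℕ} {H : Matrix (Fin n) (Fin n) ℂ} (hH : H.IsHermitian)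
    (i : Fin n) : ℝ :=
  hH.eigenvalues₀ (Fin.cast (Fintype.card_fin n).symm i)

theorem sortedEigenvalue_antitone {n : ℕ} {H : Matrix (Fin n) (Fin n) ℂ}
    (hH : H.IsHermitian) : Antitone (sortedEigenvalue hH) :=
  fun _ _ hij => hH.eigenvalues₀_antitone hij

/-- The weighted numerical range `W(A;c)`: all `v` with
`Re (e^{iθ} v) ≤ c_1 λ_1(H_θ(A)) + ⋯ + c_n λ_n(H_θ(A))` for every `θ`. -/
def weightedRange {n : ℕ} (A : Matrix (Fin n) (Fin n) ℂ) (c : Fin n → ℝ) : Set ℂ :=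
  {v | ∀ θ : ℝ, (Complex.exp (θ * Complex.I) * v).re ≤
    ∑ i, c i * sortedEigenvalue (rotatedRealPart_isHermitian A θ) i}

/-- The rank-`k` numerical range `Λ_k(A)`: all `z` with `P A P = z P` for some orthogonal
projection `P` of rank `k`. -/
def rankRange {n : ℕ} (A : Matrix (Fin n) (Fin n) ℂ) (k : ℕ) : Set ℂ :=
  {z | ∃ P : Matrix (Fin n) (Fin n) ℂ, IsStarProjection P ∧ P.rank = k ∧ P * A * P = z • P}

theorem card_roots_charpoly {n : ℕ} (A : Matrix (Fin n) (Fin n) ℂ) :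
    A.charpoly.roots.toList.length = n := by
  rw [Multiset.length_toList, ← (IsAlgClosed.splits A.charpoly).natDegree_eq_card_roots,
    Matrix.charpoly_natDegree_eq_dim, Fintype.card_fin]

/-- An enumeration `λ_1(A), …, λ_n(A)`, in some order, of the eigenvalues of `A`, with
algebraic multiplicity. The notions below do not depend on the order. -/
def eigenvalueList {n : ℕ} (A : Matrix (Fin n) (Fin n) ℂ) (i : Fin n) : ℂ :=
  A.charpoly.roots.toList.get (Fin.cast (card_roots_charpoly A).symm i)

/-- `α` is a `c`-value of `A`: if `c_{i_1}, …, c_{i_r}` are the nonzero entries of `c`, then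
`α = c_{i_1} λ_{j_1}(A) + ⋯ + c_{i_r} λ_{j_r}(A)` for some distinct `j_1, …, j_r`. -/
def IsCValue {n : ℕ} (A : Matrix (Fin n) (Fin n) ℂ) (c : Fin n → ℝ) (α : ℂ) : Prop :=
  ∃ j : {i : Fin n // c i ≠ 0} ↪ Fin n,
    α = ∑ s : {i : Fin n // c i ≠ 0}, (c s.1 : ℂ) * eigenvalueList A (j s)

/-- The coefficient vector of the linear form `∑ s, c_{i_s} x_{j_s}` in `x_1, …, x_n`. -/
def formCoeff {n : ℕ} (c : Fin n → ℝ) (j : {i : Fin n // c i ≠ 0} ↪ Fin n) : Fin n → ℝ :=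
  ∑ s : {i : Fin n // c i ≠ 0}, Pi.single (j s) (c s.1)

/-- The generically distinct `c`-values: the distinct linear forms `∑ s, c_{i_s} x_{j_s}`,
each given by its coefficient vector and counted once. -/
def genericForms {n : ℕ} (c : Fin n → ℝ) : Finset (Fin n → ℝ) :=
  Finset.univ.image (formCoeff c)

/-- The `c`-polynomial `p(A;c)`: the monic polynomial whose roots are the generically distinct
`c`-values of `A`, one factor for each of the distinct linear forms. -/
def cPoly {n : ℕ} (A : Matrix (Fin n) (Fin n) ℂ) (c : Fin n → ℝ) : Polynomial ℂ :=
  ∏ d ∈ genericForms c,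
    (Polynomial.X - Polynomial.C (∑ l, (d l : ℂ) * eigenvalueList A l))

/-- `deg(A;c)`, the degree of the `c`-polynomial. -/
def cDegree {n : ℕ} (A : Matrix (Fin n) (Fin n) ℂ) (c : Fin n → ℝ) : ℕ :=
  (cPoly A c).natDegree

end

end WeightedNumericalRange

namespace WeightedNumericalRange
open Polynomial

/-! Put `w = e^{-iθ}` and `m = deg(A;c)`. Since `A + w² A* = 2w H_θ(A)`, evaluating the
`c`-polynomial of this pencil at `2w (R + Re(e^{iθ} α)) = 2Rw + α + ᾱw²` gives a polynomial `G(w)`,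
which vanishes whenever `R + Re(e^{iθ} α)` is a `c`-value of `H_θ(A)`. On the unit circle `w^{-m}
G(w)` is real, so `G` has degree at most `2m` (`natDegree_le_of_self_reciprocal`). Each given
boundary point yields a zero of its own (`exists_support_eq_radius`): relative to `α`, the support
function is at least `R` in the outward direction of the point and at most `R` where the point
touches its line, so it equals `R` in between. Thus `2m + 1` points force `G = 0`. Modulo `w²`, `G`
is `p(A;c)` at `α + 2Rw`, so `p(α) = p'(α) = 0`.

For the rank-`k` range take `c = e_k`, for which `p(A;c)` is the characteristic polynomial. By
Courant–Fischer `Λ_k(A)` lies in `W(A;c)`. Conversely, a point `z` at which all inequalities are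
strict lies in `Λ_k(A)`: this is `hasIsotropicSubspace_of_hasPositiveSubspaces` for `T = A - z`. So
boundary points of `Λ_k(A)` touch bounding lines and the first argument applies.

The isotropic subspace is found by induction. A reducing vector is split off, at the cost of one in
`k`. Without reducing vectors `T` is congruent to a diagonal form without antipodal entries. A
generic rotation with the fewest entries in the right half plane makes the slopes of right and left
entries interlace, and each interlacing chain carries an explicit isotropic family, because divided
differences annihilate low powers. -/

/-! ### The `c`-polynomial and symmetric functions -/

theorem roots_charpoly_eq_map_eigenvalueList {n : ℕ} (A : Matrix (Fin n) (Fin n) ℂ) :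
    A.charpoly.roots = Finset.univ.val.map (eigenvalueList A) := by
  conv_lhs => rw [← Multiset.coe_toList A.charpoly.roots]
  rw [Fin.univ_val_map, Multiset.coe_eq_coe]
  apply List.Perm.of_eq
  apply List.ext_get
  · simpa using card_roots_charpoly A
  · intro i h1 h2
    simp [eigenvalueList]

theorem charpoly_eq_prod_eigenvalueList {n : ℕ} (A : Matrix (Fin n) (Fin n) ℂ) :
    A.charpoly = ∏ i, (X - C (eigenvalueList A i)) := by
  conv_lhs => rw [(IsAlgClosed.splits A.charpoly).eq_prod_roots_of_monic A.charpoly_monic,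
    roots_charpoly_eq_map_eigenvalueList, Multiset.map_map]
  rfl

theorem formCoeff_comp_perm {n : ℕ} (c : Fin n → ℝ) (j : {i : Fin n // c i ≠ 0} ↪ Fin n)
    (σ : Equiv.Perm (Fin n)) :
    formCoeff c j ∘ σ = formCoeff c (j.trans σ.symm.toEmbedding) := by
  funext l
  simp only [formCoeff, Function.comp_apply, Finset.sum_apply, Pi.single_apply,
    Function.Embedding.trans_apply, Equiv.coe_toEmbedding, Equiv.eq_symm_apply]

theorem comp_perm_mem_genericForms {n : ℕ} {c d : Fin n → ℝ} (σ : Equiv.Perm (Fin n))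
    (hd : d ∈ genericForms c) : d ∘ σ ∈ genericForms c := by
  obtain ⟨j, -, rfl⟩ := Finset.mem_image.mp hd
  rw [formCoeff_comp_perm]
  exact Finset.mem_image_of_mem _ (Finset.mem_univ _)

/-- A product over the generic forms is invariant under permutations of the coefficients. -/
theorem prod_genericForms_comp_perm {n : ℕ} {M : Type*} [CommMonoid M] (c : Fin n → ℝ)
    (σ : Equiv.Perm (Fin n)) (f : (Fin n → ℝ) → M) :
    ∏ d ∈ genericForms c, f (d ∘ σ) = ∏ d ∈ genericForms c, f d := by
  refine Finset.prod_nbij' (fun d => d ∘ σ) (fun d => d ∘ σ.symm)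
    (fun d hd => comp_perm_mem_genericForms σ hd)
    (fun d hd => comp_perm_mem_genericForms σ.symm hd) ?_ ?_ (fun _ _ => rfl)
  · intro d _; funext l; simp
  · intro d _; funext l; simp

theorem cDegree_eq_card {n : ℕ} (A : Matrix (Fin n) (Fin n) ℂ) (c : Fin n → ℝ) :
    cDegree A c = (genericForms c).card := by
  rw [cDegree, cPoly, natDegree_prod_of_monic _ _ (fun _ _ => monic_X_sub_C _),
    Finset.sum_congr rfl (fun _ _ => natDegree_X_sub_C _), Finset.card_eq_sum_ones]

theorem cPoly_monic {n : ℕ} (A : Matrix (Fin n) (Fin n) ℂ) (c : Fin n → ℝ) :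
    (cPoly A c).Monic := monic_prod_of_monic _ _ fun _ _ => monic_X_sub_C _

theorem genericForms_nonempty {n : ℕ} (c : Fin n → ℝ) : (genericForms c).Nonempty :=
  ⟨_, Finset.mem_image_of_mem _ (Finset.mem_univ (Function.Embedding.subtype _))⟩

/-- The inclusion of the support of `c` is an admissible embedding. This makes the bound `∑ c_i
λ_i(H_θ(A))` itself a `c`-value of `H_θ(A)`. -/
theorem self_mem_genericForms {n : ℕ} (c : Fin n → ℝ) : c ∈ genericForms c := by
  refine Finset.mem_image.mpr ⟨Function.Embedding.subtype _, Finset.mem_univ _, ?_⟩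
  funext l
  simp only [formCoeff, Finset.sum_apply, Function.Embedding.subtype_apply, Pi.single_apply]
  by_cases h : c l = 0
  · rw [h]
    refine Finset.sum_eq_zero fun s _ => ?_
    rw [if_neg]
    rintro rfl
    exact s.2 h
  · rw [Finset.sum_eq_single ⟨l, h⟩]
    · simp
    · intro s _ hs
      rw [if_neg]
      rintro rfl
      exact hs rfl
    · simp

theorem isCValue_of_isRoot {n : ℕ} {A : Matrix (Fin n) (Fin n) ℂ} {c : Fin n → ℝ} {α : ℂ}
    (h : (cPoly A c).IsRoot α) : IsCValue A c α := by
  rw [cPoly, IsRoot.def, eval_prod, Finset.prod_eq_zero_iff] at h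
  obtain ⟨d, hd, h⟩ := h
  obtain ⟨j, -, rfl⟩ := Finset.mem_image.mp hd
  refine ⟨j, ?_⟩
  rw [eval_sub, eval_X, eval_C, sub_eq_zero] at h
  rw [h]
  simp only [formCoeff, Finset.sum_apply, Complex.ofReal_sum, Finset.sum_mul]
  rw [Finset.sum_comm]
  refine Finset.sum_congr rfl fun s _ => ?_
  rw [Finset.sum_eq_single (j s)]
  · simp
  · intro l _ hl
    simp [hl]
  · simp

/-- The product over the generic forms is a polynomial in the elementary symmetric functions. -/
theorem exists_mvPolynomial_prod_genericForms {n : ℕ} (c : Fin n → ℝ) :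
    ∃ Ψ : MvPolynomial (Fin n) ℂ[X], ∀ x : Fin n → ℂ,
      ∏ d ∈ genericForms c, (X - C (∑ l, (d l : ℂ) * x l)) = MvPolynomial.aeval
        (fun i : Fin n => C ((Finset.univ.val.map x).esymm ((i : ℕ) + 1))) Ψ := by
  let Φ : MvPolynomial (Fin n) ℂ[X] := ∏ d ∈ genericForms c,
    (MvPolynomial.C X - ∑ l, MvPolynomial.C (C (d l : ℂ)) * MvPolynomial.X l)
  -- Permuting the variables permutes the generic forms, so the fundamental theorem of symmetric
  -- polynomials applies.
  have hΦ : Φ ∈ MvPolynomial.symmetricSubalgebra (Fin n) ℂ[X] := by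
    intro σ
    simp only [Φ, map_prod, map_sub, map_sum, map_mul, MvPolynomial.rename_C,
      MvPolynomial.rename_X]
    rw [← prod_genericForms_comp_perm c σ]
    refine Finset.prod_congr rfl fun d _ => ?_
    rw [← Equiv.sum_comp σ (fun l => MvPolynomial.C (C (d l : ℂ)) * MvPolynomial.X l)]
    simp
  let e := MvPolynomial.esymmAlgEquiv (Fin n) ℂ[X] (Fintype.card_fin n)
  have h1 : MvPolynomial.aeval (fun i : Fin n => MvPolynomial.esymm (Fin n) ℂ[X] (i + 1))
      (e.symm ⟨Φ, hΦ⟩) = Φ := by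
    have := congrArg Subtype.val (e.apply_symm_apply ⟨Φ, hΦ⟩)
    rwa [MvPolynomial.esymmAlgEquiv_apply, MvPolynomial.esymmAlgHom_apply] at this
  refine ⟨e.symm ⟨Φ, hΦ⟩, fun x => ?_⟩
  have h2 : ∏ d ∈ genericForms c, (X - C (∑ l, (d l : ℂ) * x l)) =
      MvPolynomial.aeval (fun i => C (x i)) Φ := by
    simp [Φ, map_prod]
  have h3 := congrArg (MvPolynomial.aeval (fun i => C (x i))) h1
  rw [h2, ← h3, ← AlgHom.comp_apply, MvPolynomial.comp_aeval]
  congr 2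
  funext i
  rw [MvPolynomial.aeval_esymm_eq_multiset_esymm, Finset.esymm_map_val, Finset.esymm_map_val, map_sum]
  simp only [map_prod]

/-- By symmetry the enumeration in `eigenvalueList` is irrelevant. For `H_θ(A)` the decreasing order
can then be used. -/
theorem cPoly_eq_of_roots {n : ℕ} (A : Matrix (Fin n) (Fin n) ℂ) (c : Fin n → ℝ)
    (x : Fin n → ℂ) (hx : A.charpoly.roots = Finset.univ.val.map x) :
    cPoly A c = ∏ d ∈ genericForms c, (X - C (∑ l, (d l : ℂ) * x l)) := by
  obtain ⟨Ψ, hΨ⟩ := exists_mvPolynomial_prod_genericForms c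
  rw [cPoly, hΨ, hΨ, ← hx, ← roots_charpoly_eq_map_eigenvalueList]

/-- The coefficients of the `c`-polynomial are polynomials in those of the characteristic
polynomial. -/
theorem exists_mvPolynomial_cPoly {n : ℕ} (c : Fin n → ℝ) :
    ∃ Ψ : MvPolynomial (Fin n) ℂ[X], ∀ A : Matrix (Fin n) (Fin n) ℂ,
      cPoly A c = MvPolynomial.aeval
        (fun i : Fin n => C ((-1) ^ ((i : ℕ) + 1) * A.charpoly.coeff (n - ((i : ℕ) + 1)))) Ψ := by
  obtain ⟨Ψ, hΨ⟩ := exists_mvPolynomial_prod_genericForms c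
  refine ⟨Ψ, fun A => ?_⟩
  rw [cPoly, hΨ, ← roots_charpoly_eq_map_eigenvalueList]
  congr 2
  funext i
  have hn : A.charpoly.natDegree = n := by simp
  have h := coeff_eq_esymm_roots_of_splits (IsAlgClosed.splits A.charpoly)
    (k := n - ((i : ℕ) + 1)) (by rw [hn]; omega)
  have hi : n - (n - ((i : ℕ) + 1)) = i + 1 := by omega
  rw [hn, hi, A.charpoly_monic.leadingCoeff, one_mul] at h
  rw [h, ← mul_assoc, ← mul_pow]
  simp

/-- The `c`-polynomials of a matrix pencil are the specialisations of one polynomial in two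
variables. -/
theorem exists_pencil_cPoly {n : ℕ} (c : Fin n → ℝ) (A B : Matrix (Fin n) (Fin n) ℂ) :
    ∃ Q : ℂ[X][X], ∀ s : ℂ, cPoly (A + s • B) c = Q.map (evalRingHom s) := by
  obtain ⟨Ψ, hΨ⟩ := exists_mvPolynomial_cPoly c
  let M : Matrix (Fin n) (Fin n) ℂ[X] := A.map C + (X : ℂ[X]) • B.map C
  refine ⟨MvPolynomial.eval₂ (mapRingHom C) (fun i : Fin n =>
    C ((-1) ^ ((i : ℕ) + 1) * M.charpoly.coeff (n - ((i : ℕ) + 1)))) Ψ, fun s => ?_⟩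
  have hM : M.map (evalRingHom s) = A + s • B := by
    ext i j
    simp [M]
    ring
  rw [hΨ, ← coe_mapRingHom, MvPolynomial.hom_eval₂, MvPolynomial.aeval_def]
  congr 1
  · refine RingHom.ext fun p => ?_
    have h : (evalRingHom s).comp C = RingHom.id ℂ := by ext; simp
    simp [h]
  · funext i
    rw [← hM, Matrix.charpoly_map, coeff_map, coe_mapRingHom, map_C]
    simp only [map_mul, map_pow, map_neg, map_one]

/-! ### Courant–Fischer and continuity of eigenvalues -/

/-- The real part of the quadratic form of an operator. -/
noncomputable abbrev reForm {E : Type*} [NormedAddCommGroup E] [InnerProductSpace ℂ E]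
    (T : E →ₗ[ℂ] E) (x : E) : ℝ := (inner ℂ x (T x)).re

section MinMax

variable {E : Type*} [NormedAddCommGroup E] [InnerProductSpace ℂ E] {N : ℕ}
  (b : OrthonormalBasis (Fin N) ℂ E) (T : E →ₗ[ℂ] E) (l : Fin N → ℝ)

theorem reForm_eq_sum (hT : ∀ j, T (b j) = (l j : ℂ) • b j) (x : E) :
    reForm T x = ∑ j, l j * ‖b.repr x j‖ ^ 2 := by
  have h1 : T x = ∑ j, b.repr x j • ((l j : ℂ) • b j) := by
    conv_lhs => rw [← b.sum_repr x]
    simp only [map_sum, map_smul, hT]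
  rw [reForm, h1, inner_sum, Complex.re_sum]
  refine Finset.sum_congr rfl fun j _ => ?_
  rw [inner_smul_right, inner_smul_right, ← inner_conj_symm, ← b.repr_apply_apply]
  rw [mul_left_comm, Complex.mul_conj, Complex.normSq_eq_norm_sq, ← Complex.ofReal_mul,
    Complex.ofReal_re]

theorem norm_sq_eq_sum (x : E) : ‖x‖ ^ 2 = ∑ j, ‖b.repr x j‖ ^ 2 := by
  rw [← b.repr.norm_map x, EuclideanSpace.norm_sq_eq]

theorem repr_eq_zero_of_mem_span (s : Set (Fin N)) {x : E} (hx : x ∈ Submodule.span ℂ (b '' s))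
    {j : Fin N} (hj : j ∉ s) : b.repr x j = 0 := by
  rw [← OrthonormalBasis.coe_toBasis, Module.Basis.mem_span_image] at hx
  by_contra h
  exact hj (hx (by simpa using h))

theorem finrank_span_image (s : Finset (Fin N)) :
    Module.finrank ℂ (Submodule.span ℂ (b '' s)) = s.card := by
  have h := finrank_span_eq_card (b := fun j : s => b j)
    (b.orthonormal.linearIndependent.comp _ Subtype.val_injective)
  rw [Set.image_eq_range]
  simpa using h

/-- One form of the Courant–Fischer theorem. -/
theorem le_eigenvalue_iff (hT : ∀ j, T (b j) = (l j : ℂ) • b j) (hl : Antitone l) (i : Fin N)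
    (r : ℝ) : r ≤ l i ↔ ∃ U : Submodule ℂ E, (i : ℕ) + 1 ≤ Module.finrank ℂ U ∧
      ∀ x ∈ U, r * ‖x‖ ^ 2 ≤ reForm T x := by
  have : FiniteDimensional ℂ E := b.toBasis.finiteDimensional_of_finite
  have hE : Module.finrank ℂ E = N := by simpa using Module.finrank_eq_card_basis b.toBasis
  constructor
  · intro hr
    refine ⟨Submodule.span ℂ (b '' (Finset.Iic i : Finset (Fin N))), ?_, fun x hx => ?_⟩
    · rw [finrank_span_image, Fin.card_Iic]
    · rw [reForm_eq_sum b T l hT, norm_sq_eq_sum b, Finset.mul_sum]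
      refine Finset.sum_le_sum fun j _ => ?_
      by_cases hj : j ∈ (Finset.Iic i : Finset (Fin N))
      · exact mul_le_mul_of_nonneg_right (hr.trans (hl (Finset.mem_Iic.mp hj))) (by positivity)
      · rw [repr_eq_zero_of_mem_span b _ hx (by simpa using hj)]
        simp
  · rintro ⟨U, hU, h⟩
    -- The dimensions `i + 1` and `N - i` add up to more than `N`, so `U` meets the span of the
    -- eigenvectors from `i` on, where the form is at most `l i * ‖x‖ ^ 2`.
    let W := Submodule.span ℂ (b '' (Finset.Ici i : Finset (Fin N)))
    have hW : Module.finrank ℂ W = N - i := by rw [finrank_span_image, Fin.card_Ici]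
    have hUW : U ⊓ W ≠ ⊥ := by
      intro h0
      have h1 := Submodule.finrank_sup_add_finrank_inf_eq U W
      have h2 := Submodule.finrank_le (U ⊔ W)
      rw [h0, finrank_bot] at h1
      have := i.2
      omega
    obtain ⟨x, hx, hx0⟩ := Submodule.exists_mem_ne_zero_of_ne_bot hUW
    have h1 := h x hx.1
    have h2 : reForm T x ≤ l i * ‖x‖ ^ 2 := by
      rw [reForm_eq_sum b T l hT, norm_sq_eq_sum b, Finset.mul_sum]
      refine Finset.sum_le_sum fun j _ => ?_
      by_cases hj : j ∈ (Finset.Ici i : Finset (Fin N))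
      · exact mul_le_mul_of_nonneg_right (hl (Finset.mem_Ici.mp hj)) (by positivity)
      · rw [repr_eq_zero_of_mem_span b _ hx.2 (by simpa using hj)]
        simp
    exact le_of_mul_le_mul_right (h1.trans h2) (by positivity)

end MinMax

theorem le_sortedEigenvalue_iff {n : ℕ} {H : Matrix (Fin n) (Fin n) ℂ} (hH : H.IsHermitian)
    (i : Fin n) (r : ℝ) : r ≤ sortedEigenvalue hH i ↔
      ∃ U : Submodule ℂ (EuclideanSpace ℂ (Fin n)), (i : ℕ) + 1 ≤ Module.finrank ℂ U ∧
        ∀ x ∈ U, r * ‖x‖ ^ 2 ≤ reForm H.toEuclideanLin x := by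
  have hs := Matrix.isSymmetric_toEuclideanLin_iff.mpr hH
  exact le_eigenvalue_iff (hs.eigenvectorBasis finrank_euclideanSpace) H.toEuclideanLin
    hH.eigenvalues₀ (fun j => hs.apply_eigenvectorBasis _ j) hH.eigenvalues₀_antitone
    (Fin.cast (Fintype.card_fin n).symm i) r

theorem reForm_rotatedRealPart {n : ℕ} (A : Matrix (Fin n) (Fin n) ℂ) (θ : ℝ)
    (x : EuclideanSpace ℂ (Fin n)) :
    reForm (rotatedRealPart A θ).toEuclideanLin x =
      (Complex.exp (θ * Complex.I) * inner ℂ x (A.toEuclideanLin x)).re := by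
  have h1 : inner ℂ x (A.conjTranspose.toEuclideanLin x) =
      (starRingEnd ℂ) (inner ℂ x (A.toEuclideanLin x)) := by
    rw [Matrix.toEuclideanLin_conjTranspose_eq_adjoint, LinearMap.adjoint_inner_right,
      inner_conj_symm]
  have h2 : Complex.exp (-(θ * Complex.I)) = (starRingEnd ℂ) (Complex.exp (θ * Complex.I)) := by
    rw [← Complex.exp_conj]; simp
  rw [reForm, rotatedRealPart]
  simp only [map_smul, map_add, LinearMap.smul_apply, LinearMap.add_apply, inner_smul_right,
    inner_add_right, h1, h2, ← map_mul]
  generalize Complex.exp (θ * Complex.I) * inner ℂ x (A.toEuclideanLin x) = z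
  rw [Complex.add_conj]
  simp

/-- Weyl's inequality. -/
theorem sortedEigenvalue_le_add {n : ℕ} {H K : Matrix (Fin n) (Fin n) ℂ} (hH : H.IsHermitian)
    (hK : K.IsHermitian) (ε : ℝ) (h : ∀ x : EuclideanSpace ℂ (Fin n),
      reForm H.toEuclideanLin x ≤ reForm K.toEuclideanLin x + ε * ‖x‖ ^ 2) (i : Fin n) :
    sortedEigenvalue hH i ≤ sortedEigenvalue hK i + ε := by
  rw [← sub_le_iff_le_add, le_sortedEigenvalue_iff]
  obtain ⟨U, hU, hx⟩ := (le_sortedEigenvalue_iff hH i _).mp le_rfl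
  refine ⟨U, hU, fun x hxU => ?_⟩
  linarith [hx x hxU, h x]

theorem continuous_sortedEigenvalue_rotatedRealPart {n : ℕ} (A : Matrix (Fin n) (Fin n) ℂ)
    (i : Fin n) :
    Continuous fun θ : ℝ => sortedEigenvalue (rotatedRealPart_isHermitian A θ) i := by
  set C : ℝ := ‖LinearMap.toContinuousLinearMap A.toEuclideanLin‖ with hC
  have key : ∀ θ θ' : ℝ, sortedEigenvalue (rotatedRealPart_isHermitian A θ) i ≤
      sortedEigenvalue (rotatedRealPart_isHermitian A θ') i +
        ‖Complex.exp (θ * Complex.I) - Complex.exp (θ' * Complex.I)‖ * C := by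
    intro θ θ'
    refine sortedEigenvalue_le_add _ _ _ (fun x => ?_) i
    rw [reForm_rotatedRealPart, reForm_rotatedRealPart, ← sub_le_iff_le_add', ← Complex.sub_re,
      ← sub_mul]
    refine (Complex.re_le_norm _).trans ?_
    rw [norm_mul, mul_assoc]
    refine mul_le_mul_of_nonneg_left ?_ (norm_nonneg _)
    calc ‖inner ℂ x (A.toEuclideanLin x)‖ ≤ ‖x‖ * ‖A.toEuclideanLin x‖ := norm_inner_le_norm _ _
      _ ≤ ‖x‖ * (C * ‖x‖) := by
        gcongr
        exact (LinearMap.toContinuousLinearMap A.toEuclideanLin).le_opNorm x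
      _ = C * ‖x‖ ^ 2 := by ring
  rw [continuous_iff_continuousAt]
  intro θ
  rw [ContinuousAt, tendsto_iff_norm_sub_tendsto_zero]
  refine squeeze_zero (g := fun θ' : ℝ =>
    ‖Complex.exp (θ' * Complex.I) - Complex.exp (θ * Complex.I)‖ * C) (fun _ => norm_nonneg _)
    (fun θ' => ?_) ?_
  · rw [Real.norm_eq_abs, abs_sub_le_iff]
    have h1 := key θ' θ
    have h2 := key θ θ'
    rw [norm_sub_rev] at h2
    constructor <;> linarith
  · have : Continuous fun θ' : ℝ =>
      ‖Complex.exp (θ' * Complex.I) - Complex.exp (θ * Complex.I)‖ * C := by fun_prop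
    simpa using this.tendsto θ

/-! ### The support function and the boundary of `W(A;c)` -/

/-- The right-hand side `∑ i, c_i λ_i(H_θ(A))` of the inequalities that define `W(A;c)`. -/
noncomputable def weightedSupport {n : ℕ} (A : Matrix (Fin n) (Fin n) ℂ) (c : Fin n → ℝ) (θ : ℝ) :
    ℝ :=
  ∑ i, c i * sortedEigenvalue (rotatedRealPart_isHermitian A θ) i

theorem continuous_weightedSupport {n : ℕ} (A : Matrix (Fin n) (Fin n) ℂ) (c : Fin n → ℝ) :
    Continuous (weightedSupport A c) :=
  continuous_finsetSum _ fun i _ =>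
    continuous_const.mul (continuous_sortedEigenvalue_rotatedRealPart A i)

theorem sortedEigenvalue_congr {n : ℕ} {H K : Matrix (Fin n) (Fin n) ℂ} (hH : H.IsHermitian)
    (hK : K.IsHermitian) (h : H = K) (i : Fin n) :
    sortedEigenvalue hH i = sortedEigenvalue hK i := by
  subst h; rfl

theorem weightedSupport_congr {n : ℕ} (A : Matrix (Fin n) (Fin n) ℂ) (c : Fin n → ℝ) {θ θ' : ℝ}
    (h : Complex.exp (θ * Complex.I) = Complex.exp (θ' * Complex.I)) :
    weightedSupport A c θ = weightedSupport A c θ' := by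
  refine Finset.sum_congr rfl fun i _ => ?_
  rw [sortedEigenvalue_congr _ (rotatedRealPart_isHermitian A θ')]
  rw [rotatedRealPart, rotatedRealPart, Complex.exp_neg, Complex.exp_neg, h]

theorem mem_weightedRange {n : ℕ} {A : Matrix (Fin n) (Fin n) ℂ} {c : Fin n → ℝ} {v : ℂ} :
    v ∈ weightedRange A c ↔
      ∀ θ : ℝ, (Complex.exp (θ * Complex.I) * v).re ≤ weightedSupport A c θ := Iff.rfl

theorem isClosed_weightedRange {n : ℕ} (A : Matrix (Fin n) (Fin n) ℂ) (c : Fin n → ℝ) :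
    IsClosed (weightedRange A c) := by
  have : weightedRange A c =
      ⋂ θ : ℝ, {v : ℂ | (Complex.exp (θ * Complex.I) * v).re ≤ weightedSupport A c θ} := by
    ext v
    simp [mem_weightedRange]
  rw [this]
  exact isClosed_iInter fun θ => isClosed_le (by fun_prop) continuous_const

theorem exp_toIocMod (a θ : ℝ) :
    Complex.exp (toIocMod Real.two_pi_pos a θ * Complex.I) = Complex.exp (θ * Complex.I) := by
  rw [Complex.exp_eq_exp_iff_exists_int]
  refine ⟨-toIocDiv Real.two_pi_pos a θ, ?_⟩
  rw [toIocMod]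
  simp only [zsmul_eq_mul]
  push_cast
  ring

/-- The points at which all the inequalities that define `W(A;c)` are strict form an open set. -/
theorem exists_ball_strict {n : ℕ} {A : Matrix (Fin n) (Fin n) ℂ} {c : Fin n → ℝ} {v : ℂ}
    (h : ∀ θ : ℝ, (Complex.exp (θ * Complex.I) * v).re < weightedSupport A c θ) :
    ∃ ε > 0, ∀ v' ∈ Metric.ball v ε, ∀ θ : ℝ,
      (Complex.exp (θ * Complex.I) * v').re < weightedSupport A c θ := by
  have hc : Continuous fun θ : ℝ =>
      weightedSupport A c θ - (Complex.exp (θ * Complex.I) * v).re :=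
    (continuous_weightedSupport A c).sub (by fun_prop)
  -- By periodicity the minimal gap over one period bounds all gaps; it serves as the radius.
  obtain ⟨θ₀, -, hmin⟩ := (isCompact_Icc (a := 0) (b := 0 + 2 * Real.pi)).exists_isMinOn
    (Set.nonempty_Icc.mpr (by linarith [Real.two_pi_pos])) hc.continuousOn
  refine ⟨_, sub_pos.mpr (h θ₀), fun v' hv' θ => ?_⟩
  have h1 := hmin (Set.Ioc_subset_Icc_self (toIocMod_mem_Ioc Real.two_pi_pos 0 θ))
  simp only [Set.mem_ofPred_eq, exp_toIocMod, weightedSupport_congr A c (exp_toIocMod 0 θ)] at h1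
  rw [mem_ball_iff_norm] at hv'
  have h2 : (Complex.exp (θ * Complex.I) * (v' - v)).re ≤ ‖v' - v‖ := by
    refine (Complex.re_le_norm _).trans ?_
    rw [norm_mul, Complex.norm_exp_ofReal_mul_I, one_mul]
  rw [mul_sub, Complex.sub_re] at h2
  linarith

theorem exists_eq_weightedSupport_of_mem_frontier {n : ℕ} {A : Matrix (Fin n) (Fin n) ℂ}
    {c : Fin n → ℝ} {v : ℂ} (h : v ∈ frontier (weightedRange A c)) :
    v ∈ weightedRange A c ∧
      ∃ θ : ℝ, (Complex.exp (θ * Complex.I) * v).re = weightedSupport A c θ := by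
  have hv : v ∈ weightedRange A c := (isClosed_weightedRange A c).frontier_subset h
  refine ⟨hv, ?_⟩
  by_contra! hne
  obtain ⟨ε, hε, hb⟩ := exists_ball_strict fun θ => (hv θ).lt_of_ne (hne θ)
  refine h.2 (mem_interior.mpr ⟨Metric.ball v ε, fun v' hv' => ?_, Metric.isOpen_ball,
    Metric.mem_ball_self hε⟩)
  exact fun θ => (hb v' hv' θ).le

/-! ### Points on a circle and directions of support -/

theorem re_exp_mul (θ : ℝ) (z : ℂ) :
    (Complex.exp (θ * Complex.I) * z).re = Real.cos θ * z.re - Real.sin θ * z.im := by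
  rw [Complex.mul_re, Complex.exp_ofReal_mul_I_re, Complex.exp_ofReal_mul_I_im]

/-- A sinusoid of period `2π` is determined by its values at two angles that do not differ by a
multiple of `π`. -/
theorem re_exp_mul_interpolation (a b x : ℝ) (z : ℂ) :
    (Complex.exp (x * Complex.I) * z).re * Real.sin (b - a) =
      (Complex.exp (a * Complex.I) * z).re * Real.sin (b - x) +
        (Complex.exp (b * Complex.I) * z).re * Real.sin (x - a) := by
  simp only [re_exp_mul, Real.sin_sub]
  ring

/-- On an arc shorter than `π` both interpolation weights are nonnegative, and the weight of the
positive value at `a` vanishes only at the other end. -/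
theorem re_exp_mul_pos_of_between {a b x : ℝ} {z : ℂ} (hab : |b - a| < Real.pi)
    (hx : x ∈ Set.uIcc a b) (hxb : x = b → a = b)
    (ha : 0 < (Complex.exp (a * Complex.I) * z).re)
    (hb : 0 ≤ (Complex.exp (b * Complex.I) * z).re) :
    0 < (Complex.exp (x * Complex.I) * z).re := by
  have key := re_exp_mul_interpolation a b x z
  rw [abs_lt] at hab
  rcases lt_trichotomy a b with h | h | h
  · rw [Set.uIcc_of_le h.le] at hx
    have hxb' : x < b := hx.2.lt_of_ne fun e => h.ne (hxb e)
    have h1 : 0 < Real.sin (b - a) := Real.sin_pos_of_pos_of_lt_pi (by linarith) hab.2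
    have h2 : 0 < Real.sin (b - x) :=
      Real.sin_pos_of_pos_of_lt_pi (by linarith) (by linarith [hx.1])
    have h3 : 0 ≤ Real.sin (x - a) :=
      Real.sin_nonneg_of_nonneg_of_le_pi (by linarith [hx.1]) (by linarith)
    refine pos_of_mul_pos_left ?_ h1.le
    rw [key]
    positivity
  · subst h
    obtain rfl : x = a := by simpa using hx
    exact ha
  · rw [Set.uIcc_of_ge h.le] at hx
    have hxb' : b < x := hx.1.lt_of_ne fun e => h.ne' (hxb e.symm)
    have h1 : 0 < Real.sin (a - b) := Real.sin_pos_of_pos_of_lt_pi (by linarith) (by linarith)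
    have h2 : 0 < Real.sin (x - b) :=
      Real.sin_pos_of_pos_of_lt_pi (by linarith) (by linarith [hx.2])
    have h3 : 0 ≤ Real.sin (a - x) :=
      Real.sin_nonneg_of_nonneg_of_le_pi (by linarith [hx.2]) (by linarith)
    refine pos_of_mul_pos_left ?_ h1.le
    have key' : (Complex.exp (x * Complex.I) * z).re * Real.sin (a - b) =
        (Complex.exp (a * Complex.I) * z).re * Real.sin (x - b) +
          (Complex.exp (b * Complex.I) * z).re * Real.sin (a - x) := by
      simp only [re_exp_mul, Real.sin_sub]
      ring
    rw [key']
    positivity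

theorem re_lt_of_norm_eq {z : ℂ} {R : ℝ} (hz : ‖z‖ = R) (h : z ≠ R) : z.re < R := by
  refine lt_of_le_of_ne (hz ▸ Complex.re_le_norm z) fun h1 => h ?_
  rw [← hz] at h1 ⊢
  rw [Complex.re_eq_norm] at h1
  exact (Complex.eq_re_of_ofReal_le h1).trans (by rw [(Complex.re_eq_norm).mpr h1])

/-- If `S` dominates the support function of each point of a set on a circle about the origin, with
equality somewhere, then `S` takes the value `R` once for each of the points. -/
theorem exists_support_eq_radius {S : ℝ → ℝ} (hS : Continuous S)
    (hper : ∀ θ θ' : ℝ, Complex.exp (θ * Complex.I) = Complex.exp (θ' * Complex.I) → S θ = S θ')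
    {R : ℝ} (hR : 0 < R) {T : Set ℂ} (hT : T.Nontrivial) (hnorm : ∀ v ∈ T, ‖v‖ = R)
    (hle : ∀ v ∈ T, ∀ θ : ℝ, (Complex.exp (θ * Complex.I) * v).re ≤ S θ)
    (heq : ∀ v ∈ T, ∃ θ : ℝ, (Complex.exp (θ * Complex.I) * v).re = S θ) {v : ℂ} (hv : v ∈ T) :
    ∃ ξ : ℝ, S ξ = R ∧ ∀ v' ∈ T, v' ≠ v →
      (Complex.exp (ξ * Complex.I) * v').re < (Complex.exp (ξ * Complex.I) * v).re := by
  -- The outward direction of `v`, in which `v` attains its norm.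
  set a : ℝ := -v.arg with ha
  have hva : Complex.exp (a * Complex.I) * v = R := by
    conv_lhs => rw [← Complex.norm_mul_exp_arg_mul_I v]
    rw [mul_left_comm, ← Complex.exp_add, hnorm v hv, ha]
    simp
  obtain ⟨θ₁, hθ₁⟩ := heq v hv
  -- The touching direction is moved to within `π` of `a`.
  set b : ℝ := toIocMod Real.two_pi_pos (a - Real.pi) θ₁ with hb
  have hbe : Complex.exp (b * Complex.I) = Complex.exp (θ₁ * Complex.I) := exp_toIocMod _ _
  have hbm : b ∈ Set.Ioc (a - Real.pi) (a - Real.pi + 2 * Real.pi) := toIocMod_mem_Ioc _ _ _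
  have hvb : (Complex.exp (b * Complex.I) * v).re = S b := by
    rw [hbe, hθ₁, hper b θ₁ hbe]
  have hDa : ∀ v' ∈ T, v' ≠ v → 0 < (Complex.exp (a * Complex.I) * (v - v')).re := by
    intro v' hv' hne
    rw [mul_sub, Complex.sub_re, hva, Complex.ofReal_re, sub_pos]
    refine re_lt_of_norm_eq (by rw [norm_mul, Complex.norm_exp_ofReal_mul_I, one_mul, hnorm v' hv'])
      fun h => hne ?_
    rw [← hva] at h
    exact mul_left_cancel₀ (Complex.exp_ne_zero _) h
  have hDb : ∀ v' ∈ T, 0 ≤ (Complex.exp (b * Complex.I) * (v - v')).re := by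
    intro v' hv'
    rw [mul_sub, Complex.sub_re, hvb, sub_nonneg]
    exact hle v' hv' b
  -- At `b = a + π` the comparison of `v` with another point would be reversed, against `hDb`.
  have hab : |b - a| < Real.pi := by
    rw [abs_lt]
    refine ⟨by linarith [hbm.1], lt_of_le_of_ne (by linarith [hbm.2]) fun h => ?_⟩
    obtain ⟨v', hv', hne⟩ := hT.exists_ne v
    have h1 := hDa v' hv' hne
    have h2 := hDb v' hv'
    have h3 : b = a + Real.pi := by linarith
    rw [re_exp_mul] at h1 h2
    rw [h3, Real.cos_add_pi, Real.sin_add_pi] at h2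
    linarith
  have hSa : R ≤ S a := by simpa [hva] using hle v hv a
  have hSb : S b ≤ R := by
    rw [← hvb]
    refine (Complex.re_le_norm _).trans ?_
    rw [norm_mul, Complex.norm_exp_ofReal_mul_I, one_mul, hnorm v hv]
  obtain ⟨ξ, hξ, hSξ⟩ := intermediate_value_uIcc (hS.continuousOn (s := Set.uIcc a b))
    (Set.mem_uIcc.mpr (Or.inr ⟨hSb, hSa⟩))
  refine ⟨ξ, hSξ, fun v' hv' hne => ?_⟩
  rw [← sub_pos, ← Complex.sub_re, ← mul_sub]
  refine re_exp_mul_pos_of_between hab hξ (fun h => ?_) (hDa v' hv' hne) (hDb v' hv')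
  -- If `ξ = b`, then `Re(e^{ib} v) = R = ‖v‖`, so `e^{ib} = e^{ia}`, and `|b - a| < π` leaves only
  -- `a = b`.
  rw [h, ← hvb] at hSξ
  by_contra hne'
  have h1 : Complex.exp (b * Complex.I) * v = R := by
    by_contra h2
    refine (re_lt_of_norm_eq ?_ h2).ne hSξ
    rw [norm_mul, Complex.norm_exp_ofReal_mul_I, one_mul, hnorm v hv]
  rw [← hva] at h1
  have h2 := mul_right_cancel₀ (norm_pos_iff.mp (by rw [hnorm v hv]; exact hR)) h1
  rw [Complex.exp_eq_exp_iff_exists_int] at h2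
  obtain ⟨m, hm⟩ := h2
  have h3 : b - a = m * (2 * Real.pi) := by
    have := congrArg Complex.im hm
    simp at this
    linarith
  have h4 : m = 0 := by
    rw [h3, abs_lt] at hab
    have h5 : (m : ℝ) < 1 := by nlinarith [Real.pi_pos]
    have h6 : (-1 : ℝ) < m := by nlinarith [Real.pi_pos]
    have h7 : m < 1 := by exact_mod_cast h5
    have h8 : -1 < m := by exact_mod_cast h6
    omega
  rw [h4] at h3
  apply hne'
  simp at h3
  linarith

/-! ### The pencil polynomial and the multiple root -/

theorem roots_charpoly_smul {n : ℕ} (H : Matrix (Fin n) (Fin n) ℂ) {k : ℂ} (hk : k ≠ 0)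
    {x : Fin n → ℂ} (hx : H.charpoly.roots = Finset.univ.val.map x) :
    (k • H).charpoly.roots = Finset.univ.val.map fun i => k * x i := by
  have h1 : H.charpoly = ∏ i, (X - C (x i)) := by
    conv_lhs => rw [(IsAlgClosed.splits H.charpoly).eq_prod_roots_of_monic H.charpoly_monic, hx,
      Multiset.map_map]
    rfl
  have h2 : (k • H).charpoly = ∏ i, (X - C (k * x i)) := by
    refine Polynomial.funext fun t => ?_
    have h3 : Matrix.scalar (Fin n) t - k • H = k • (Matrix.scalar (Fin n) (t / k) - H) := by
      rw [smul_sub]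
      congr 1
      ext i j
      simp only [Matrix.scalar_apply, Matrix.smul_apply, Matrix.diagonal_apply, smul_eq_mul]
      split_ifs
      · field_simp
      · simp
    rw [Matrix.eval_charpoly, h3, Matrix.det_smul, ← Matrix.eval_charpoly, h1, eval_prod, eval_prod,
      Fintype.card, ← Finset.prod_const, ← Finset.prod_mul_distrib]
    refine Finset.prod_congr rfl fun i _ => ?_
    simp only [eval_sub, eval_X, eval_C]
    field_simp
  rw [h2, Finset.prod_eq_multiset_prod, ← Function.comp_def (fun a : ℂ => X - C a),
    ← Multiset.map_map, roots_multiset_prod_X_sub_C]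

theorem roots_charpoly_sortedEigenvalue {n : ℕ} {H : Matrix (Fin n) (Fin n) ℂ}
    (hH : H.IsHermitian) :
    H.charpoly.roots = Finset.univ.val.map fun i => (sortedEigenvalue hH i : ℂ) := by
  rw [hH.roots_charpoly_eq_eigenvalues₀,
    ← Multiset.map_univ_val_equiv (finCongr (Fintype.card_fin n).symm), Multiset.map_map]
  rfl

/-- With `w = e^{-iθ}` this trades the trigonometric family `H_θ(A)` for a family polynomial in `w`.
-/
theorem pencil_eq_smul_rotatedRealPart {n : ℕ} (A : Matrix (Fin n) (Fin n) ℂ) (θ : ℝ) :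
    A + Complex.exp (-(θ * Complex.I)) ^ 2 • A.conjTranspose =
      (2 * Complex.exp (-(θ * Complex.I))) • rotatedRealPart A θ := by
  have h : Complex.exp (-(θ * Complex.I)) * Complex.exp (θ * Complex.I) = 1 := by
    rw [← Complex.exp_add]; simp
  rw [rotatedRealPart, smul_smul, smul_add, smul_smul, smul_smul]
  congr 1
  · rw [mul_one_div, mul_div_cancel_left₀ _ two_ne_zero, h, one_smul]
  · congr 1; ring

theorem cPoly_pencil_eval {n : ℕ} (A : Matrix (Fin n) (Fin n) ℂ) (c : Fin n → ℝ) (θ r : ℝ) :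
    (cPoly (A + Complex.exp (-(θ * Complex.I)) ^ 2 • A.conjTranspose) c).eval
        (2 * Complex.exp (-(θ * Complex.I)) * r) =
      (2 * Complex.exp (-(θ * Complex.I))) ^ cDegree A c *
        ((∏ d ∈ genericForms c,
          (r - ∑ l, d l * sortedEigenvalue (rotatedRealPart_isHermitian A θ) l) : ℝ) : ℂ) := by
  rw [pencil_eq_smul_rotatedRealPart, cPoly_eq_of_roots _ c _ (roots_charpoly_smul _
    (mul_ne_zero two_ne_zero (Complex.exp_ne_zero _))
    (roots_charpoly_sortedEigenvalue (rotatedRealPart_isHermitian A θ))), eval_prod, cDegree_eq_card,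
    ← Finset.prod_const, Complex.ofReal_prod, ← Finset.prod_mul_distrib]
  refine Finset.prod_congr rfl fun d _ => ?_
  rw [eval_sub, eval_X, eval_C, Complex.ofReal_sub, mul_sub, Complex.ofReal_sum, Finset.mul_sum]
  congr 1
  refine Finset.sum_congr rfl fun l _ => ?_
  push_cast
  ring

theorem infinite_range_exp : (Set.range fun θ : ℝ => Complex.exp (-(θ * Complex.I))).Infinite := by
  refine ((Set.Icc_infinite Real.pi_pos).image (f := fun θ : ℝ => Complex.exp (-(θ * Complex.I)))
    fun x hx y hy h => Real.injOn_cos hx hy ?_).mono (Set.image_subset_range _ _)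
  have := congrArg Complex.re h
  simpa [Complex.exp_re] using this

/-- A polynomial of which a multiple by `w ^ (-m)` is real on the unit circle has degree at
most `2 * m`. -/
theorem natDegree_le_of_self_reciprocal {G : ℂ[X]} {m : ℕ}
    (h : ∀ θ : ℝ, (starRingEnd ℂ) (G.eval (Complex.exp (-(θ * Complex.I)))) *
      Complex.exp (-(θ * Complex.I)) ^ m = G.eval (Complex.exp (-(θ * Complex.I)))) :
    G.natDegree ≤ m := by
  by_cases hG : G = 0
  · simp [hG]
  set F := G.map (starRingEnd ℂ) with hF
  have hFd : F.natDegree = G.natDegree := natDegree_map _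
  -- On the unit circle `conj w = w⁻¹`, so the hypothesis gives this identity at infinitely many
  -- points. Comparing degrees suffices, since `F.reverse` has degree at most that of `G`.
  have key : X ^ m * F.reverse = X ^ G.natDegree * G := by
    refine eq_of_infinite_eval_eq _ _ (infinite_range_exp.mono ?_)
    rintro _ ⟨θ, rfl⟩
    set w := Complex.exp (-(θ * Complex.I)) with hw
    have hw0 : w ≠ 0 := Complex.exp_ne_zero _
    have hwc : (starRingEnd ℂ) w = w⁻¹ := by
      rw [hw, ← Complex.exp_conj, ← Complex.exp_neg]; simp
    let _ : Invertible w⁻¹ := invertibleOfNonzero (inv_ne_zero hw0)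
    have h1 := eval₂_reverse_mul_pow (RingHom.id ℂ) w⁻¹ F
    have h2 : F.eval w⁻¹ = (starRingEnd ℂ) (G.eval w) := by
      rw [hF, ← hwc, eval_map, eval₂_at_apply]
    rw [invOf_eq_inv, inv_inv, hFd, eval₂_id, eval₂_id, h2] at h1
    change eval w _ = eval w _
    rw [eval_mul, eval_mul, eval_pow, eval_pow, eval_X, ← h θ, ← hw, ← h1]
    have h3 : w ^ G.natDegree * w⁻¹ ^ G.natDegree = 1 := by
      rw [← mul_pow, mul_inv_cancel₀ hw0, one_pow]
    linear_combination (-(eval w F.reverse * w ^ m)) * h3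
  have h1 := congrArg natDegree key
  have hF0 : F.reverse ≠ 0 := by simpa [reverse_eq_zero, hF] using hG
  rw [natDegree_mul (pow_ne_zero _ X_ne_zero) hF0, natDegree_mul (pow_ne_zero _ X_ne_zero) hG,
    natDegree_X_pow, natDegree_X_pow] at h1
  have h2 := reverse_natDegree_le F
  omega

/-- The polynomial in `w = e^{-iθ}` obtained from the `c`-polynomial of `2 w H_θ(A)` at
`2 w (R + Re (e^{iθ} α))`. -/
theorem exists_pencil_polynomial {n : ℕ} (A : Matrix (Fin n) (Fin n) ℂ) (c : Fin n → ℝ) (α : ℂ)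
    (R : ℝ) : ∃ G : ℂ[X],
      (∀ w : ℂ, G.eval w = (cPoly (A + w ^ 2 • A.conjTranspose) c).eval
        (2 * R * w + α + (starRingEnd ℂ) α * w ^ 2)) ∧
      X ^ 2 ∣ G - (cPoly A c).comp (C (2 * R : ℂ) * X + C α + C ((starRingEnd ℂ) α) * X ^ 2) := by
  obtain ⟨Q, hQ⟩ := exists_pencil_cPoly c A A.conjTranspose
  set τ : ℂ[X] := C (2 * R : ℂ) * X + C α + C ((starRingEnd ℂ) α) * X ^ 2 with hτ
  refine ⟨Q.eval₂ (compRingHom (X ^ 2)) τ, fun w => ?_, ?_⟩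
  · rw [hQ, ← coe_evalRingHom, hom_eval₂, coe_evalRingHom, eval_map]
    congr 1
    · ext <;> simp
    · simp [hτ]
  -- Modulo `X ^ 2` the pencil parameter `w²` becomes `0`, which leaves the `c`-polynomial of `A`.
  · have h0 : cPoly A c = Q.map (evalRingHom 0) := by rw [← hQ]; simp
    rw [h0, comp, eval₂_map, ← Ideal.mem_span_singleton, ← Ideal.Quotient.eq, hom_eval₂, hom_eval₂]
    congr 1
    refine Polynomial.ringHom_ext (fun a => by simp) ?_
    simp only [RingHom.comp_apply, coe_compRingHom_apply, X_comp, coe_evalRingHom, eval_X, map_zero]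
    exact Ideal.Quotient.eq_zero_iff_mem.mpr (Ideal.mem_span_singleton_self _)

/-- The core of the theorem: the points need only lie in `W(A;c)` and on supporting lines. -/
theorem one_lt_rootMultiplicity_cPoly {n : ℕ} (A : Matrix (Fin n) (Fin n) ℂ) (c : Fin n → ℝ)
    (α : ℂ) {R : ℝ} (hR : 0 < R) (S : Finset ℂ) (hS : 2 * cDegree A c < S.card)
    (hsph : ∀ z ∈ S, z ∈ Metric.sphere α R) (hmem : ∀ z ∈ S, z ∈ weightedRange A c)
    (heq : ∀ z ∈ S, ∃ θ : ℝ, (Complex.exp (θ * Complex.I) * z).re = weightedSupport A c θ) :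
    1 < (cPoly A c).rootMultiplicity α := by
  -- Positive degree provides at least three points, hence the nontriviality required below.
  have hd : 0 < cDegree A c := by
    rw [cDegree_eq_card]; exact (genericForms_nonempty c).card_pos
  set f : ℝ → ℝ := fun θ => weightedSupport A c θ - (Complex.exp (θ * Complex.I) * α).re with hf
  have hfc : Continuous f := (continuous_weightedSupport A c).sub (by fun_prop)
  have hzero : ∀ z : S, ∃ ξ : ℝ, f ξ = R ∧ ∀ z' : S, z' ≠ z →
      (Complex.exp (ξ * Complex.I) * (z' - α)).re < (Complex.exp (ξ * Complex.I) * (z - α)).re := by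
    intro z
    obtain ⟨ξ, h1, h2⟩ := exists_support_eq_radius (T := (fun z => z - α) '' (S : Set ℂ)) hfc
      (fun θ θ' h => by simp only [hf]; rw [weightedSupport_congr A c h, h]) hR
      (Set.Nontrivial.image (Finset.one_lt_card_iff_nontrivial.mp (by omega)) (sub_left_injective))
      (by rintro _ ⟨z, hz, rfl⟩; simpa [dist_eq_norm] using hsph z hz)
      (by
        rintro _ ⟨z, hz, rfl⟩ θ
        have := hmem z hz θ
        simp only [hf, mul_sub, Complex.sub_re]
        exact sub_le_sub_right this _)
      (by
        rintro _ ⟨z, hz, rfl⟩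
        obtain ⟨θ, h⟩ := heq z hz
        exact ⟨θ, by simp only [hf, mul_sub, Complex.sub_re, h]⟩)
      (Set.mem_image_of_mem _ z.2)
    exact ⟨ξ, h1, fun z' hne => h2 _ (Set.mem_image_of_mem _ z'.2)
      fun h => hne (Subtype.ext (sub_left_injective h))⟩
  choose ξ hξ hsep using hzero
  obtain ⟨G, hG, hdvd⟩ := exists_pencil_polynomial A c α R
  have hGe : ∀ θ : ℝ, G.eval (Complex.exp (-(θ * Complex.I))) =
      (2 * Complex.exp (-(θ * Complex.I))) ^ cDegree A c *
        ((∏ d ∈ genericForms c, (R + (Complex.exp (θ * Complex.I) * α).re -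
          ∑ l, d l * sortedEigenvalue (rotatedRealPart_isHermitian A θ) l) : ℝ) : ℂ) := by
    intro θ
    rw [hG, ← cPoly_pencil_eval]
    congr 1
    have h : Complex.exp (-(θ * Complex.I)) * Complex.exp (θ * Complex.I) = 1 := by
      rw [← Complex.exp_add]; simp
    have h2 : (starRingEnd ℂ) (Complex.exp (θ * Complex.I)) = Complex.exp (-(θ * Complex.I)) := by
      rw [← Complex.exp_conj]; simp
    have h1 : (((Complex.exp (θ * Complex.I) * α).re : ℝ) : ℂ) =
        (Complex.exp (θ * Complex.I) * α + Complex.exp (-(θ * Complex.I)) * (starRingEnd ℂ) α) / 2 := by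
      rw [Complex.re_eq_add_conj, map_mul, h2]
    rw [Complex.ofReal_add, h1]
    linear_combination (-α) * h
  -- The product in `hGe` is real, so conjugation only inverts the power of `w`; the reciprocal
  -- exponent is `2m`.
  have hdeg : G.natDegree ≤ 2 * cDegree A c := by
    refine natDegree_le_of_self_reciprocal fun θ => ?_
    rw [hGe, map_mul, Complex.conj_ofReal, map_pow, map_mul, map_ofNat, ← Complex.exp_conj, map_neg,
      map_mul, Complex.conj_ofReal, Complex.conj_I, mul_neg, neg_neg, two_mul (cDegree A c), pow_add,
      mul_pow, mul_pow]
    have h : Complex.exp (θ * Complex.I) ^ cDegree A c *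
        Complex.exp (-(θ * Complex.I)) ^ cDegree A c = 1 := by
      rw [← mul_pow, ← Complex.exp_add]; simp
    linear_combination (2 ^ cDegree A c * Complex.exp (-(θ * Complex.I)) ^ cDegree A c *
      ((∏ d ∈ genericForms c, (R + (Complex.exp (θ * Complex.I) * α).re -
          ∑ l, d l * sortedEigenvalue (rotatedRealPart_isHermitian A θ) l) : ℝ) : ℂ)) * h
  have hG0 : G = 0 := by
    refine eq_zero_of_natDegree_lt_card_of_eval_eq_zero G
      (f := fun z : S => Complex.exp (-(ξ z * Complex.I))) ?_ (fun z => ?_) ?_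
    · intro z z' h
      by_contra hne
      have h1 := hsep z z' (Ne.symm hne)
      have h2 := hsep z' z hne
      simp only [Complex.exp_neg, inv_inj] at h
      rw [h] at h1
      exact lt_asymm h1 h2
    · rw [hGe, Finset.prod_eq_zero (self_mem_genericForms c)]
      · simp
      · have := hξ z
        simp only [hf, weightedSupport] at this
        linarith
    · rw [Fintype.card_coe]
      omega
  rw [hG0, zero_sub, dvd_neg] at hdvd
  obtain ⟨F, hF⟩ := hdvd
  -- The two lowest coefficients of `p(α + 2Rw + ᾱw²)` are `p(α)` and `2R p'(α)`.
  rw [one_lt_rootMultiplicity_iff_isRoot (cPoly_monic A c).ne_zero]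
  have h1 := congrArg (eval 0) hF
  have h2 := congrArg (fun p => eval 0 (derivative p)) hF
  simp [eval_comp, derivative_comp] at h1 h2
  exact ⟨h1, by simpa [hR.ne'] using h2⟩

/-! ### Isotropic subspaces: splitting off a reducing vector -/

section Isotropic

variable {E : Type*} [NormedAddCommGroup E] [InnerProductSpace ℂ E] [FiniteDimensional ℂ E]

/-- For each rotation of `T`, the real part of the quadratic form is positive definite on some
subspace of dimension at least `k`. -/
def HasPositiveSubspaces (T : E →ₗ[ℂ] E) (k : ℕ) : Prop :=
  ∀ u : ℂ, u ≠ 0 → ∃ U : Submodule ℂ E, k ≤ Module.finrank ℂ U ∧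
    ∀ x ∈ U, x ≠ 0 → 0 < (u * inner ℂ x (T x)).re

/-- The quadratic form of `T` vanishes on some subspace of dimension at least `k`. -/
def HasIsotropicSubspace (T : E →ₗ[ℂ] E) (k : ℕ) : Prop :=
  ∃ U : Submodule ℂ E, k ≤ Module.finrank ℂ U ∧ ∀ x ∈ U, inner ℂ x (T x) = 0

/-- The compression of `T` to `L`. -/
noncomputable def compression (T : E →ₗ[ℂ] E) (L : Submodule ℂ E) : L →ₗ[ℂ] L :=
  (L.orthogonalProjectionOnto : E →ₗ[ℂ] L) ∘ₗ T ∘ₗ L.subtype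

theorem inner_compression (T : E →ₗ[ℂ] E) (L : Submodule ℂ E) (a b : L) :
    inner ℂ a (compression T L b) = inner ℂ (a : E) (T b) :=
  Submodule.inner_orthogonalProjectionOnto_eq_of_mem_left a (T b)

theorem adjoint_compression (T : E →ₗ[ℂ] E) (L : Submodule ℂ E) :
    LinearMap.adjoint (compression T L) = compression (LinearMap.adjoint T) L := by
  refine LinearMap.ext fun a => ext_inner_left ℂ fun b => ?_
  rw [LinearMap.adjoint_inner_right, inner_compression, LinearMap.adjoint_inner_right,
    ← inner_conj_symm, inner_compression, inner_conj_symm]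

/-- An isotropic vector at which `T` and its adjoint are linearly dependent. -/
def IsReducing (T : E →ₗ[ℂ] E) (x : E) : Prop :=
  x ≠ 0 ∧ inner ℂ x (T x) = 0 ∧
    ∃ μ ν : ℂ, (μ ≠ 0 ∨ ν ≠ 0) ∧ μ • T x + ν • LinearMap.adjoint T x = 0

theorem inner_adjoint_self (T : E →ₗ[ℂ] E) (x : E) :
    inner ℂ x (LinearMap.adjoint T x) = (starRingEnd ℂ) (inner ℂ x (T x)) := by
  rw [LinearMap.adjoint_inner_right, inner_conj_symm]

/-- Dependence puts `T x` and its adjoint counterpart on one line, which is orthogonal to `x`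
because `x` is isotropic. -/
theorem IsReducing.exists_direction {T : E →ₗ[ℂ] E} {x : E} (h : IsReducing T x) :
    ∃ (y : E) (p q : ℂ), inner ℂ x y = 0 ∧ T x = p • y ∧ LinearMap.adjoint T x = q • y := by
  obtain ⟨-, h0, μ, ν, hμν, h1⟩ := h
  by_cases hμ : μ = 0
  · have hν : ν ≠ 0 := by tauto
    refine ⟨T x, 1, 0, h0, by simp, ?_⟩
    rw [hμ, zero_smul, zero_add] at h1
    simpa [hν] using h1
  · refine ⟨LinearMap.adjoint T x, -(ν / μ), 1, ?_, ?_, by simp⟩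
    · rw [inner_adjoint_self, h0, map_zero]
    · have h2 : μ • T x = -(ν • LinearMap.adjoint T x) := eq_neg_of_add_eq_zero_left h1
      rw [← inv_smul_smul₀ hμ (T x), h2, smul_neg, smul_smul, neg_smul]
      congr 2
      ring

/-- The vector `x` lies in the radical of the form restricted to the complement of `y`, on the left
and on the right. -/
theorem inner_add_smul_of_direction {T : E →ₗ[ℂ] E} {x y : E} {p q : ℂ} (hxy : inner ℂ x y = 0)
    (hp : T x = p • y) (hq : LinearMap.adjoint T x = q • y) {a : E} (ha : inner ℂ y a = 0) (c : ℂ) :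
    inner ℂ (a + c • x) (T (a + c • x)) = inner ℂ a (T a) := by
  have ha' : inner ℂ a y = 0 := inner_eq_zero_symm.mp ha
  have h1 : inner ℂ x (T a) = 0 := by
    rw [← LinearMap.adjoint_inner_left, hq, inner_smul_left, ha, mul_zero]
  simp only [map_add, map_smul, hp, inner_add_left, inner_add_right, inner_smul_left,
    inner_smul_right, h1, hxy, ha']
  ring

theorem finrank_le_inf_orthogonal_singleton (U : Submodule ℂ E) (v : E) :
    Module.finrank ℂ U ≤ Module.finrank ℂ (U ⊓ (ℂ ∙ v)ᗮ : Submodule ℂ E) + 1 := by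
  have h1 := Submodule.finrank_sup_add_finrank_inf_eq U (ℂ ∙ v)ᗮ
  have h2 := Submodule.finrank_le (U ⊔ (ℂ ∙ v)ᗮ)
  have h3 := Submodule.finrank_add_finrank_orthogonal (ℂ ∙ v)
  have h4 := finrank_span_le_card (R := ℂ) ({v} : Set E)
  simp at h4
  omega

theorem finrank_sup_span_singleton_of_notMem {U : Submodule ℂ E} {x : E} (hx : x ∉ U) :
    Module.finrank ℂ (U ⊔ ℂ ∙ x : Submodule ℂ E) = Module.finrank ℂ U + 1 := by
  have h0 : x ≠ 0 := fun h => hx (h ▸ U.zero_mem)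
  have h1 := Submodule.finrank_sup_add_finrank_inf_eq U (ℂ ∙ x)
  have h2 : U ⊓ ℂ ∙ x = ⊥ := by
    rw [← disjoint_iff, disjoint_comm]
    exact (Submodule.disjoint_span_singleton' h0).mpr hx |>.symm
  rw [h2, finrank_bot, finrank_span_singleton h0] at h1
  omega

/-- Intersecting `U` with the complement of `y` costs at most one dimension. Projecting along `x`
then costs none, since the isotropic `x` is not in `U`, and it does not change the form. -/
theorem HasPositiveSubspaces.compression {T : E →ₗ[ℂ] E} {x y : E} {p q : ℂ} (hx : x ≠ 0)
    (hxy : inner ℂ x y = 0) (hp : T x = p • y) (hq : LinearMap.adjoint T x = q • y) {k : ℕ}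
    (h : HasPositiveSubspaces T (k + 1)) :
    HasPositiveSubspaces (compression T ((ℂ ∙ y)ᗮ ⊓ (ℂ ∙ x)ᗮ)) k := by
  intro u hu
  obtain ⟨U, hU, hpos⟩ := h u hu
  set U₁ := U ⊓ (ℂ ∙ y)ᗮ with hU₁
  set V := (U₁ ⊔ ℂ ∙ x) ⊓ (ℂ ∙ x)ᗮ with hV
  have hxU : x ∉ U₁ := fun hmem => by
    have := hpos x hmem.1 hx
    rw [hp, inner_smul_right, hxy] at this
    simp at this
  have hdim : k ≤ Module.finrank ℂ V := by
    have h1 := finrank_le_inf_orthogonal_singleton U y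
    have h2 := finrank_le_inf_orthogonal_singleton (U₁ ⊔ ℂ ∙ x) x
    rw [finrank_sup_span_singleton_of_notMem hxU, ← hV] at h2
    rw [← hU₁] at h1
    omega
  have hle : V ≤ (ℂ ∙ y)ᗮ ⊓ (ℂ ∙ x)ᗮ := by
    refine inf_le_inf_right _ (sup_le inf_le_right ?_)
    rw [Submodule.span_singleton_le_iff_mem, Submodule.mem_orthogonal_singleton_iff_inner_right]
    exact inner_eq_zero_symm.mp hxy
  refine ⟨V.comap ((ℂ ∙ y)ᗮ ⊓ (ℂ ∙ x)ᗮ).subtype, ?_, fun a ha ha0 => ?_⟩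
  · rwa [(Submodule.comapSubtypeEquivOfLe hle).finrank_eq]
  · rw [inner_compression]
    obtain ⟨a₁, ha₁, z, hz, haz⟩ := Submodule.mem_sup.mp (Submodule.mem_comap.mp ha).1
    obtain ⟨c, rfl⟩ := Submodule.mem_span_singleton.mp hz
    change a₁ + c • x = (a : E) at haz
    rw [← haz, inner_add_smul_of_direction hxy hp hq
      (Submodule.mem_orthogonal_singleton_iff_inner_right.mp ha₁.2)]
    refine hpos a₁ ha₁.1 fun h0 => ha0 ?_
    rw [h0, zero_add] at haz
    have h1 : inner ℂ (a : E) (a : E) = 0 := by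
      nth_rewrite 1 [← haz]
      rw [inner_smul_left, Submodule.mem_orthogonal_singleton_iff_inner_right.mp a.2.2,
        mul_zero]
    exact Subtype.ext (inner_self_eq_zero.mp h1)

/-- Adjoining `x`, which lies in the radical, regains the lost dimension. -/
theorem HasIsotropicSubspace.of_compression {T : E →ₗ[ℂ] E} {x y : E} {p q : ℂ} (hx : x ≠ 0)
    (hxy : inner ℂ x y = 0) (hp : T x = p • y) (hq : LinearMap.adjoint T x = q • y) {k : ℕ}
    (h : HasIsotropicSubspace (compression T ((ℂ ∙ y)ᗮ ⊓ (ℂ ∙ x)ᗮ)) k) :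
    HasIsotropicSubspace T (k + 1) := by
  set L := (ℂ ∙ y)ᗮ ⊓ (ℂ ∙ x)ᗮ with hL
  obtain ⟨U, hU, hiso⟩ := h
  have hxU : x ∉ U.map L.subtype := by
    rintro ⟨a, -, hax⟩
    have h1 : inner ℂ x (L.subtype a) = 0 :=
      Submodule.mem_orthogonal_singleton_iff_inner_right.mp a.2.2
    rw [hax] at h1
    exact hx (inner_self_eq_zero.mp h1)
  refine ⟨U.map L.subtype ⊔ ℂ ∙ x, ?_, fun z hz => ?_⟩
  · rw [finrank_sup_span_singleton_of_notMem hxU,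
      Submodule.finrank_map_subtype_eq]
    omega
  · obtain ⟨_, ⟨a, ha, rfl⟩, w, hw, rfl⟩ := Submodule.mem_sup.mp hz
    obtain ⟨c, rfl⟩ := Submodule.mem_span_singleton.mp hw
    change inner ℂ ((a : E) + c • x) (T ((a : E) + c • x)) = 0
    rw [inner_add_smul_of_direction hxy hp hq
      (Submodule.mem_orthogonal_singleton_iff_inner_right.mp a.2.1)]
    have := hiso a ha
    rwa [inner_compression] at this

end Isotropic

/-! ### Diagonalisation by congruence -/

/-- Without reducing vectors, `T` is diagonalised by a congruence. -/
theorem exists_diagonal_family (N : ℕ) : ∀ {E : Type*} [NormedAddCommGroup E]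
    [InnerProductSpace ℂ E] [FiniteDimensional ℂ E] (T : E →ₗ[ℂ] E),
    Module.finrank ℂ E = N → (∀ x, ¬ IsReducing T x) →
    ∃ (b : Fin N → E) (ζ : Fin N → ℂ), (∀ i, ζ i ≠ 0) ∧
      ∀ i j, inner ℂ (b i) (T (b j)) = if i = j then ζ i else 0 := by
  induction N with
  | zero => exact fun T _ _ => ⟨Fin.elim0, Fin.elim0, fun i => i.elim0, fun i => i.elim0⟩
  | succ N ih =>
    intro E _ _ _ T hE hT
    have hinj : Function.Injective T := by
      rw [← LinearMap.ker_eq_bot, LinearMap.ker_eq_bot']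
      intro x hx
      by_contra hx0
      exact hT x ⟨hx0, by simp [hx], 1, 0, by simp, by simp [hx]⟩
    let e := LinearEquiv.ofInjectiveEndo T hinj
    have : Nontrivial E := Module.nontrivial_of_finrank_pos (R := ℂ) (by omega)
    -- An eigenvector `x` of `T⁻¹ T*` satisfies `T* x = λ T x`. Not being reducing it is not
    -- isotropic, and the complement of `T x` is orthogonal to `x` for the form on both sides.
    obtain ⟨lam, hlam⟩ := Module.End.exists_eigenvalue
      ((e.symm : E →ₗ[ℂ] E) ∘ₗ LinearMap.adjoint T)
    obtain ⟨x, hx⟩ := hlam.exists_hasEigenvector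
    have hx0 : x ≠ 0 := hx.2
    have hadj : LinearMap.adjoint T x = lam • T x := by
      have h1 := congrArg e hx.apply_eq_smul
      simpa [e] using h1
    have hζ : inner ℂ x (T x) ≠ 0 := fun h0 => hT x ⟨hx0, h0, lam, -1, by simp, by simp [hadj]⟩
    set L := (ℂ ∙ T x)ᗮ with hL
    have hmem : ∀ a : L, inner ℂ (T x) (a : E) = 0 := fun a =>
      Submodule.mem_orthogonal_singleton_iff_inner_right.mp a.2
    have hxa : ∀ a : L, inner ℂ x (T a) = 0 := fun a => by
      rw [← LinearMap.adjoint_inner_left, hadj, inner_smul_left, hmem, mul_zero]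
    have hax : ∀ a : L, inner ℂ (a : E) (T x) = 0 := fun a => inner_eq_zero_symm.mp (hmem a)
    have hLdim : Module.finrank ℂ L = N := by
      have h1 := Submodule.finrank_add_finrank_orthogonal (ℂ ∙ T x)
      rw [finrank_span_singleton (fun h => hζ (by simp [h])), ← hL] at h1
      omega
    obtain ⟨b, ζ, hζ', hb⟩ := ih (compression T L) hLdim (by
      -- A reducing vector of the compression reduces `T`: the combination is a multiple of `T x`,
      -- and pairing with `x` shows that it vanishes.
      rintro a ⟨ha0, haa, μ, ν, hμν, h⟩
      refine hT a ⟨fun h => ha0 (Subtype.ext h), by rwa [inner_compression] at haa, μ, ν, hμν, ?_⟩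
      rw [adjoint_compression] at h
      have h1 : L.orthogonalProjectionOnto (μ • T a + ν • LinearMap.adjoint T a) = 0 := by
        rw [map_add, map_smul, map_smul]
        exact h
      have h1' : μ • T a + ν • LinearMap.adjoint T a ∈ (ℂ ∙ T x)ᗮᗮ :=
        Submodule.orthogonalProjectionOnto_eq_zero_iff.mp h1
      rw [Submodule.orthogonal_orthogonal] at h1'
      obtain ⟨c, hc⟩ := Submodule.mem_span_singleton.mp h1'
      have h2 : inner ℂ x (c • T x) = 0 := by
        rw [hc, inner_add_right, inner_smul_right, inner_smul_right, hxa,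
          LinearMap.adjoint_inner_right, hmem]
        simp
      rw [inner_smul_right] at h2
      have h3 : c = 0 := (mul_eq_zero.mp h2).resolve_right hζ
      rw [← hc, h3, zero_smul])
    refine ⟨Fin.cons x fun i => (b i : E), Fin.cons (inner ℂ x (T x)) ζ, ?_, ?_⟩
    · intro i
      refine Fin.cases ?_ (fun i => ?_) i
      · simpa using hζ
      · simpa using hζ' i
    · intro i j
      refine Fin.cases ?_ (fun i => ?_) i <;> refine Fin.cases ?_ (fun j => ?_) j
      · simp
      · simp [hxa, (Fin.succ_ne_zero j).symm]
      · simp [hax]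
      · have := hb i j
        rw [inner_compression] at this
        simpa using this

/-- Linearly independent vectors that are pairwise (and each by itself) orthogonal with respect to
the diagonal form with entries `ζ`. -/
def IsotropicFamily {ι κ : Type*} [Fintype ι] (ζ : ι → ℂ) (w : κ → ι → ℂ) : Prop :=
  LinearIndependent ℂ w ∧ ∀ e f, ∑ x, (starRingEnd ℂ) (w e x) * w f x * ζ x = 0

section Diagonal

variable {E : Type*} [NormedAddCommGroup E] [InnerProductSpace ℂ E]
  {T : E →ₗ[ℂ] E} {N : ℕ} {b : Fin N → E} {ζ : Fin N → ℂ}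

theorem inner_sum_diagonal (hb : ∀ i j, inner ℂ (b i) (T (b j)) = if i = j then ζ i else 0)
    (c d : Fin N → ℂ) : inner ℂ (∑ i, c i • b i) (T (∑ i, d i • b i)) =
      ∑ i, (starRingEnd ℂ) (c i) * d i * ζ i := by
  simp only [map_sum, map_smul, sum_inner, inner_sum, inner_smul_left, inner_smul_right, hb]
  refine Finset.sum_congr rfl fun i _ => ?_
  simp
  ring

theorem linearIndependent_of_diagonal (hζ : ∀ i, ζ i ≠ 0)
    (hb : ∀ i j, inner ℂ (b i) (T (b j)) = if i = j then ζ i else 0) :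
    LinearIndependent ℂ b := by
  rw [Fintype.linearIndependent_iff]
  intro c hc i
  have h := inner_sum_diagonal hb (Pi.single i 1) c
  rw [hc, map_zero, inner_zero_right, Finset.sum_eq_single i] at h
  · simpa [hζ i] using h.symm
  · intro j _ hj
    simp [hj]
  · simp

theorem IsotropicFamily.hasIsotropicSubspace {κ : Type*} [Fintype κ] {w : κ → Fin N → ℂ}
    (hw : IsotropicFamily ζ w) (hζ : ∀ i, ζ i ≠ 0)
    (hb : ∀ i j, inner ℂ (b i) (T (b j)) = if i = j then ζ i else 0) :
    HasIsotropicSubspace T (Fintype.card κ) := by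
  set v : κ → E := fun e => ∑ i, w e i • b i with hv
  have hlin : LinearIndependent ℂ v := by
    exact hw.1.map' (Fintype.linearCombination ℂ b) (LinearMap.ker_eq_bot.mpr
      (linearIndependent_iff_injective_fintypeLinearCombination.mp
        (linearIndependent_of_diagonal hζ hb)))
  refine ⟨Submodule.span ℂ (Set.range v), (finrank_span_eq_card hlin).ge, fun x hx => ?_⟩
  have hvx : ∀ y ∈ Submodule.span ℂ (Set.range v), ∀ e, inner ℂ (v e) (T y) = 0 := by
    intro y hy e
    induction hy using Submodule.span_induction with
    | mem y hy =>
      obtain ⟨f, rfl⟩ := hy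
      rw [hv]
      exact (inner_sum_diagonal hb _ _).trans (hw.2 e f)
    | zero => simp
    | add y z _ _ hy hz => rw [map_add, inner_add_right, hy, hz, add_zero]
    | smul a y _ hy => rw [map_smul, inner_smul_right, hy, mul_zero]
  have hxx : ∀ y ∈ Submodule.span ℂ (Set.range v), inner ℂ y (T x) = 0 := by
    intro y hy
    induction hy using Submodule.span_induction with
    | mem y hy =>
      obtain ⟨f, rfl⟩ := hy
      exact hvx x hx f
    | zero => simp
    | add y z _ _ hy hz => rw [inner_add_left, hy, hz, add_zero]
    | smul a y _ hy => rw [inner_smul_left, hy, mul_zero]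
  exact hxx x hx

variable [FiniteDimensional ℂ E]

/-- The basis that belongs to a diagonalisation by congruence. -/
noncomputable def diagonalBasis (hE : Module.finrank ℂ E = N) (hζ : ∀ i, ζ i ≠ 0)
    (hb : ∀ i j, inner ℂ (b i) (T (b j)) = if i = j then ζ i else 0) : Module.Basis (Fin N) ℂ E :=
  basisOfLinearIndependentOfCardEqFinrank' b (linearIndependent_of_diagonal hζ hb)
    (by rw [hE, Fintype.card_fin])

theorem diagonalBasis_apply (hE : Module.finrank ℂ E = N) (hζ : ∀ i, ζ i ≠ 0)
    (hb : ∀ i j, inner ℂ (b i) (T (b j)) = if i = j then ζ i else 0) (i : Fin N) :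
    diagonalBasis hE hζ hb i = b i := by
  simp [diagonalBasis]

/-- On the span of the `b i` with `Re(u ζ_i) ≤ 0` the rotated form is nonpositive, so this span
meets a positive subspace only in `0`. -/
theorem le_card_of_diagonal (hE : Module.finrank ℂ E = N)
    (hζ : ∀ i, ζ i ≠ 0) (hb : ∀ i j, inner ℂ (b i) (T (b j)) = if i = j then ζ i else 0) {k : ℕ}
    (hT : HasPositiveSubspaces T k) {u : ℂ} (hu : u ≠ 0) :
    k ≤ (Finset.univ.filter fun i => 0 < (u * ζ i).re).card := by
  obtain ⟨U, hU, hpos⟩ := hT u hu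
  set B := diagonalBasis hE hζ hb with hB
  set s := Finset.univ.filter fun i => ¬ 0 < (u * ζ i).re with hs
  set V := Submodule.span ℂ (B '' s) with hV
  have hVdim : Module.finrank ℂ V = s.card := by
    have h := finrank_span_eq_card (b := fun j : s => B j)
      (B.linearIndependent.comp _ Subtype.val_injective)
    rw [hV, Set.image_eq_range]
    simpa using h
  have hUV : U ⊓ V = ⊥ := by
    rw [Submodule.eq_bot_iff]
    rintro x ⟨hxU, hxV⟩
    by_contra hx0
    have h1 := hpos x hxU hx0
    have h2 : x = ∑ i, B.repr x i • b i := by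
      conv_lhs => rw [← B.sum_repr x]
      simp only [hB, diagonalBasis_apply]
    rw [h2, inner_sum_diagonal hb, Finset.mul_sum, Complex.re_sum] at h1
    refine absurd h1 (not_lt.mpr (Finset.sum_nonpos fun i _ => ?_))
    by_cases hi : i ∈ s
    · rw [mul_left_comm, ← Complex.normSq_eq_conj_mul_self, Complex.re_ofReal_mul]
      exact mul_nonpos_of_nonneg_of_nonpos (Complex.normSq_nonneg _)
        (not_lt.mp (Finset.mem_filter.mp hi).2)
    · have h3 : B.repr x i = 0 := by
        by_contra h
        exact hi ((B.mem_span_image.mp hxV) (by simpa using h))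
      simp [h3]
  have h1 := Submodule.finrank_sup_add_finrank_inf_eq U V
  have h2 := Submodule.finrank_le (U ⊔ V)
  have h3 : (Finset.univ.filter fun i => 0 < (u * ζ i).re).card + s.card = N := by
    rw [hs, Finset.card_filter_add_card_filter_not, Finset.card_univ, Fintype.card_fin]
  rw [hUV, finrank_bot] at h1
  omega

/-- If `ζ i = -r ζ j`, then `b i + √r • b j` is isotropic, and the ratio `conj ζ / ζ` that links `T`
to its adjoint is the same at `i` and `j`; the vector would be reducing. -/
theorem ne_antipodal_of_diagonal (hE : Module.finrank ℂ E = N)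
    (hζ : ∀ i, ζ i ≠ 0) (hb : ∀ i j, inner ℂ (b i) (T (b j)) = if i = j then ζ i else 0)
    (hT : ∀ x, ¬ IsReducing T x) {i j : Fin N} (hij : i ≠ j) {r : ℝ} (hr : 0 < r) :
    ζ i + r * ζ j ≠ 0 := by
  intro h0
  set B := diagonalBasis hE hζ hb with hB
  have hadj : ∀ l, LinearMap.adjoint T (b l) = ((starRingEnd ℂ) (ζ l) / ζ l) • T (b l) := by
    intro l
    have h : innerₛₗ ℂ (LinearMap.adjoint T (b l)) =
        innerₛₗ ℂ (((starRingEnd ℂ) (ζ l) / ζ l) • T (b l)) := by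
      refine B.ext fun m => ?_
      rw [hB, diagonalBasis_apply, innerₛₗ_apply_apply, innerₛₗ_apply_apply, inner_smul_left,
        LinearMap.adjoint_inner_left, ← inner_conj_symm (T (b l)), hb, hb]
      by_cases hlm : l = m
      · subst hlm
        simp [hζ l]
      · simp [hlm, Ne.symm hlm]
    exact ext_inner_right ℂ fun v => congrArg (fun f => f v) h
  have hi : ζ i = -(r * ζ j) := eq_neg_of_add_eq_zero_left h0
  have hr0 : (r : ℂ) ≠ 0 := by exact_mod_cast hr.ne'
  have hlam : (starRingEnd ℂ) (ζ i) / ζ i = (starRingEnd ℂ) (ζ j) / ζ j := by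
    have := hζ j
    rw [hi, map_neg, map_mul, Complex.conj_ofReal]
    field_simp
  set s : ℂ := (Real.sqrt r : ℂ) with hs
  have hss : (starRingEnd ℂ) s * s = r := by
    rw [hs, Complex.conj_ofReal, ← Complex.ofReal_mul, Real.mul_self_sqrt hr.le]
  refine hT (b i + s • b j) ⟨fun h => ?_, ?_, (starRingEnd ℂ) (ζ j) / ζ j, -1, by simp, ?_⟩
  · have h1 := congrArg (fun x => inner ℂ x (T (b i))) h
    simp [hb, hij.symm, hζ i] at h1
  · simp only [map_add, map_smul, inner_add_left, inner_add_right, inner_smul_left,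
      inner_smul_right, hb, hij, hij.symm, if_true, if_false]
    linear_combination h0 + ζ j * hss
  · simp only [map_add, map_smul, hadj, hlam, smul_add]
    module

end Diagonal

/-! ### Isotropic families from interlacing chains -/

section Families

variable {ι κ : Type*} [Fintype ι]

theorem IsotropicFamily.comp_injective {κ' : Type*} {ζ : ι → ℂ} {w : κ → ι → ℂ}
    (hw : IsotropicFamily ζ w) {g : κ' → κ} (hg : Function.Injective g) :
    IsotropicFamily ζ (w ∘ g) :=
  ⟨hw.1.comp g hg, fun e f => hw.2 (g e) (g f)⟩

theorem IsotropicFamily.extend {ι' : Type*} [Fintype ι'] {ζ : ι → ℂ} {g : ι' → ι}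
    (hg : Function.Injective g) {w : κ → ι' → ℂ} (hw : IsotropicFamily (ζ ∘ g) w) :
    IsotropicFamily ζ fun e => Function.extend g (w e) 0 := by
  refine ⟨?_, fun e f => ?_⟩
  · refine LinearIndependent.of_comp (LinearMap.funLeft ℂ ℂ g) ?_
    convert hw.1 using 1
    funext e i
    simp [LinearMap.funLeft_apply, hg.extend_apply]
  · rw [← hw.2 e f]
    symm
    refine Fintype.sum_of_injective g hg _ _ (fun x hx => ?_) fun i => ?_
    · dsimp only
      rw [Function.extend_apply' _ _ _ (by simpa using hx)]
      simp
    · simp [hg.extend_apply]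

theorem IsotropicFamily.sigma {d : ℕ} {ι κ : Fin d → Type*} [∀ r, Fintype (ι r)]
    {ζ : (Σ r, ι r) → ℂ} {w : ∀ r, κ r → ι r → ℂ}
    (hw : ∀ r, IsotropicFamily (fun x => ζ ⟨r, x⟩) (w r)) :
    IsotropicFamily ζ fun (e : Σ r, κ r) (x : Σ r, ι r) =>
      (Pi.single e.1 (w e.1 e.2) : ∀ r, ι r → ℂ) x.1 x.2 := by
  refine ⟨?_, ?_⟩
  · have h := Pi.linearIndependent_single w fun r => (hw r).1
    exact LinearIndependent.of_comp
      (LinearEquiv.piCurry ℂ fun (r : Fin d) (_ : ι r) => ℂ).toLinearMap h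
  · rintro ⟨r, e⟩ ⟨r', f⟩
    rw [Fintype.sum_sigma, Finset.sum_eq_single r]
    · by_cases hr : r = r'
      · subst hr
        simpa using (hw r).2 e f
      · simp [Pi.single_eq_of_ne hr]
    · intro s _ hs
      simp [Pi.single_eq_of_ne hs]
    · simp

end Families

/-- This divided difference is the top coefficient in the Lagrange interpolation of `X ^ j`, which
has lower degree. -/
theorem sum_pow_div_prod_sub_eq_zero {ν : Type*} [Fintype ν] [DecidableEq ν] {t : ν → ℝ}
    (ht : Function.Injective t) {j : ℕ} (hj : j + 1 < Fintype.card ν) :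
    ∑ x, t x ^ j / ∏ y, (if y = x then 1 else t x - t y) = 0 := by
  have h := Lagrange.coeff_eq_sum (s := Finset.univ) (v := t) ht.injOn (P := (X : ℝ[X]) ^ j)
    (by rw [degree_X_pow, Finset.card_univ]; exact_mod_cast (by omega))
  rw [coeff_X_pow, if_neg (by rw [Finset.card_univ]; omega)] at h
  rw [h]
  refine Finset.sum_congr rfl fun x _ => ?_
  rw [eval_pow, eval_X]
  congr 1
  rw [← Finset.mul_prod_erase Finset.univ _ (Finset.mem_univ x), if_pos rfl, one_mul]
  exact Finset.prod_congr rfl fun y hy => if_neg (Finset.ne_of_mem_erase hy)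

/-- Let `D x` be the product in `hρ`. For the vectors `t x ^ e / √(-ρ x * D x)` the real and
imaginary parts of the pairing are minus the divided differences of `t ^ (e + f)` and `t ^ (e + f +
1)`, and `e + f + 1 < 2m`. -/
theorem exists_isotropicFamily_of_sign {ν : Type*} [Fintype ν] [DecidableEq ν] {t ρ : ν → ℝ}
    (ht : Function.Injective t) {m : ℕ} (hm : Fintype.card ν = 2 * m + 1)
    (hρ : ∀ x, ρ x * ∏ y, (if y = x then 1 else t x - t y) < 0) :
    ∃ w : Fin m → ν → ℂ, IsotropicFamily (fun x => (ρ x : ℂ) * (1 + t x * Complex.I)) w := by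
  set D : ν → ℝ := fun x => ∏ y, (if y = x then 1 else t x - t y) with hD
  have hpos : ∀ x, 0 < Real.sqrt (-(ρ x * D x)) := fun x => Real.sqrt_pos.mpr (neg_pos.mpr (hρ x))
  refine ⟨fun e x => ((t x ^ (e : ℕ) / Real.sqrt (-(ρ x * D x)) : ℝ) : ℂ), ?_, fun e f => ?_⟩
  · rw [Fintype.linearIndependent_iff]
    intro g hg
    set P : ℂ[X] := ∑ e : Fin m, C (g e) * X ^ (e : ℕ) with hP
    have hP0 : P = 0 := by
      refine eq_zero_of_natDegree_lt_card_of_eval_eq_zero P (f := fun x : ν => (t x : ℂ))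
        (fun x y h => ht (Complex.ofReal_injective h)) (fun x => ?_) ?_
      · have h := congrFun hg x
        have hx : ((Real.sqrt (-(ρ x * D x)) : ℝ) : ℂ) ≠ 0 := by exact_mod_cast (hpos x).ne'
        simp only [Finset.sum_apply, Pi.smul_apply, smul_eq_mul, Pi.zero_apply, Complex.ofReal_div,
          Complex.ofReal_pow, ← mul_div_assoc] at h
        rw [← Finset.sum_div, div_eq_zero_iff, or_iff_left hx] at h
        rw [hP, eval_finsetSum, ← h]
        simp
      · have h : P.natDegree ≤ m := natDegree_le_of_degree_le (degree_sum_fin_lt g).le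
        omega
    intro e
    have h := congrArg (fun p => p.coeff (e : ℕ)) hP0
    simpa [hP, finsetSum_coeff, coeff_X_pow, Fin.val_inj] using h
  · have hterm : ∀ x, (starRingEnd ℂ) ((t x ^ (e : ℕ) / Real.sqrt (-(ρ x * D x)) : ℝ) : ℂ) *
        ((t x ^ (f : ℕ) / Real.sqrt (-(ρ x * D x)) : ℝ) : ℂ) * ((ρ x : ℂ) * (1 + t x * Complex.I)) =
        -((t x ^ ((e : ℕ) + f) / D x : ℝ) : ℂ) +
          -((t x ^ ((e : ℕ) + f + 1) / D x : ℝ) : ℂ) * Complex.I := by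
      intro x
      have h1 : t x ^ (e : ℕ) / Real.sqrt (-(ρ x * D x)) *
          (t x ^ (f : ℕ) / Real.sqrt (-(ρ x * D x))) * ρ x = -(t x ^ ((e : ℕ) + f) / D x) := by
        have h2 : ∀ {r y : ℝ} (z : ℝ), r ≠ 0 → y ≠ 0 → z / -(r * y) * r = -(z / y) := by
          intro r y z hr hy
          field_simp
        have h3 : ρ x ≠ 0 := left_ne_zero_of_mul (hρ x).ne
        have h4 : D x ≠ 0 := right_ne_zero_of_mul (hρ x).ne
        rw [div_mul_div_comm, Real.mul_self_sqrt (neg_pos.mpr (hρ x)).le, ← pow_add]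
        exact h2 _ h3 h4
      rw [Complex.conj_ofReal, ← mul_assoc, ← Complex.ofReal_mul, ← Complex.ofReal_mul, h1, pow_succ]
      push_cast
      ring
    simp only [hterm, Finset.sum_add_distrib, ← Finset.sum_mul, Finset.sum_neg_distrib,
      ← Complex.ofReal_sum]
    have he := e.2
    have hf := f.2
    rw [hD, sum_pow_div_prod_sub_eq_zero ht (by omega), sum_pow_div_prod_sub_eq_zero ht (by omega)]
    simp

/-- The case of strictly interlacing real parameters. -/
theorem exists_isotropicFamily_of_interlacing {m : ℕ} {a : Fin m → ℝ} {b : Fin (m + 1) → ℝ}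
    (hba : ∀ i, b i.castSucc < a i) (hab : ∀ i, a i < b i.succ) {ρ : Fin (m + 1) ⊕ Fin m → ℝ}
    (hneg : ∀ l, ρ (Sum.inl l) < 0) (hpos : ∀ i, 0 < ρ (Sum.inr i)) :
    ∃ w : Fin m → (Fin (m + 1) ⊕ Fin m) → ℂ, IsotropicFamily
      (fun x => (ρ x : ℂ) * (1 + (Sum.elim b a x : ℝ) * Complex.I)) w := by
  have hb : StrictMono b := Fin.strictMono_iff_lt_succ.mpr fun i => (hba i).trans (hab i)
  have hlt : ∀ l i, l ≤ Fin.castSucc i → b l < a i := fun l i h => (hb.monotone h).trans_lt (hba i)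
  have hgt : ∀ l i, Fin.castSucc i < l → a i < b l := fun l i h =>
    (hab i).trans_le (hb.monotone (Fin.castSucc_lt_iff_succ_le.mp h))
  have ha : StrictMono a := fun i j h => (hgt j.castSucc i (by simpa using h)).trans (hba j)
  have hne : ∀ l i, b l ≠ a i := fun l i => by
    rcases le_or_gt l (Fin.castSucc i) with h | h
    · exact (hlt l i h).ne
    · exact (hgt l i h).ne'
  refine exists_isotropicFamily_of_sign (t := Sum.elim b a)
    (hb.injective.sumElim ha.injective hne) (by simp; ring) ?_
  rintro (l | j)
  · refine mul_neg_of_neg_of_pos (hneg l) ?_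
    -- Each `a i` is paired with a `b` on the same side of `b l`.
    rw [Fintype.prod_sum_type, Fin.prod_univ_succAbove _ l]
    simp only [if_true, one_mul, Sum.inl.injEq, Fin.succAbove_ne, if_false, reduceCtorEq,
      Sum.elim_inl, Sum.elim_inr, ← Finset.prod_mul_distrib]
    refine Finset.prod_pos fun i _ => ?_
    rcases lt_or_ge (Fin.castSucc i) l with h | h
    · rw [Fin.succAbove_of_castSucc_lt _ _ h]
      exact mul_pos (sub_pos.mpr (hb h)) (sub_pos.mpr (hgt l i h))
    · rw [Fin.succAbove_of_le_castSucc _ _ h]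
      exact mul_pos_of_neg_of_neg (sub_neg.mpr (hb (h.trans_lt Fin.castSucc_lt_succ)))
        (sub_neg.mpr (hlt l i h))
  · refine mul_neg_of_pos_of_neg (hpos j) ?_
    -- The factor `a j - b j.succ` supplies the sign; the others pair off positively.
    rw [Fintype.prod_sum_type, Fin.prod_univ_succAbove _ j.succ]
    simp only [reduceCtorEq, if_false, Sum.inr.injEq, Sum.elim_inl, Sum.elim_inr, mul_assoc,
      ← Finset.prod_mul_distrib]
    refine mul_neg_of_neg_of_pos (sub_neg.mpr (hab j)) (Finset.prod_pos fun i _ => ?_)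
    rcases lt_trichotomy i j with h | h | h
    · rw [if_neg h.ne, Fin.succAbove_of_castSucc_lt _ _ (by rw [Fin.lt_def] at *; simp; omega)]
      exact mul_pos (sub_pos.mpr (hlt _ _ (by simpa using h.le))) (sub_pos.mpr (ha h))
    · subst h
      rw [if_pos rfl, mul_one, Fin.succAbove_of_castSucc_lt _ _ Fin.castSucc_lt_succ]
      exact sub_pos.mpr (hba i)
    · rw [if_neg h.ne', Fin.succAbove_of_le_castSucc _ _ (by rw [Fin.lt_def] at h; rw [Fin.le_def]; simp; omega)]
      exact mul_pos_of_neg_of_neg (sub_neg.mpr ((ha h).trans (hab i))) (sub_neg.mpr (ha h))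

theorem exists_monotone_enumeration {ι : Type*} [DecidableEq ι] (s : Finset ι) (t : ι → ℝ) {p : ℕ}
    (hp : s.card = p) : ∃ e : Fin p → ι, Function.Injective e ∧ (∀ i, e i ∈ s) ∧
      (∀ x ∈ s, ∃ i, e i = x) ∧ Monotone (t ∘ e) := by
  let e₀ := s.equivFinOfCardEq hp
  let σ := Tuple.sort fun i => t (e₀.symm i)
  refine ⟨fun i => e₀.symm (σ i), ?_, fun i => (e₀.symm (σ i)).2, fun x hx => ?_, ?_⟩
  · exact Subtype.val_injective.comp (e₀.symm.injective.comp σ.injective)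
  · exact ⟨σ.symm (e₀ ⟨x, hx⟩), by simp⟩
  · exact Tuple.monotone_sort fun i => t (e₀.symm i)

theorem add_mul_inj {d r r' j j' : ℕ} (hr : r < d) (hr' : r' < d) (h : r + j * d = r' + j' * d) :
    r = r' ∧ j = j' := by
  have h1 := congrArg (· % d) h
  have h2 := congrArg (· / d) h
  have hd : 0 < d := by omega
  simp only [Nat.add_mul_mod_self_right, Nat.mod_eq_of_lt hr, Nat.mod_eq_of_lt hr',
    Nat.add_mul_div_right _ _ hd, Nat.div_eq_of_lt hr, Nat.div_eq_of_lt hr', zero_add] at h1 h2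
  exact ⟨h1, h2⟩

section Chains

variable {ι : Type*} [Fintype ι] {ρ t : ι → ℝ} {p q : ℕ}
  {eA : Fin p → ι} {eB : Fin q → ι}

/-- A diagonal form whose positive and negative entries interlace at distance `q - p` has an
isotropic family of size `p`. -/
theorem exists_isotropicFamily_of_chains (hpq : p < q) (hA : Function.Injective eA)
    (hB : Function.Injective eB) (hApos : ∀ i, 0 < ρ (eA i)) (hBneg : ∀ l, ρ (eB l) < 0)
    (hlt : ∀ (i : Fin p) (l : Fin q), (l : ℕ) = i → t (eB l) < t (eA i))
    (hgt : ∀ (i : Fin p) (l : Fin q), (l : ℕ) = i + (q - p) → t (eA i) < t (eB l)) :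
    ∃ w : Fin p → ι → ℂ, IsotropicFamily (fun x => (ρ x : ℂ) * (1 + t x * Complex.I)) w := by
  obtain ⟨d, rfl⟩ : ∃ d, q = p + d := ⟨q - p, by omega⟩
  have hd : 0 < d := by omega
  rw [Nat.add_sub_cancel_left] at hgt
  -- The number of indices below `p` congruent to `r` modulo `d`. Chain `r` reads `B_r, A_r,
  -- B_{r+d}, A_{r+d}, …` and ends in a `B`.
  let m : Fin d → ℕ := fun r => (p + d - 1 - r) / d
  have hm : ∀ (r : Fin d) (j : ℕ), j < m r ↔ (r : ℕ) + j * d < p := by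
    intro r j
    have hr := r.2
    change j + 1 ≤ (p + d - 1 - r) / d ↔ _
    rw [Nat.le_div_iff_mul_le hd, add_mul]
    omega
  have hm' : ∀ (r : Fin d) (j : Fin (m r + 1)), (r : ℕ) + j * d < p + d := by
    intro r j
    have hr := r.2
    rcases Nat.eq_zero_or_pos (j : ℕ) with h | h
    · rw [h]; omega
    · obtain ⟨j', hj'⟩ : ∃ j', (j : ℕ) = j' + 1 := ⟨j - 1, by omega⟩
      have h1 := (hm r j').mp (by have := j.2; omega)
      rw [hj', add_mul]
      omega
  let g : (Σ r : Fin d, Fin (m r + 1) ⊕ Fin (m r)) → ι := fun x =>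
    Sum.elim (fun j : Fin (m x.1 + 1) => eB ⟨x.1 + j * d, hm' x.1 j⟩)
      (fun j : Fin (m x.1) => eA ⟨x.1 + j * d, (hm x.1 j).mp j.2⟩) x.2
  have hg : Function.Injective g := by
    have hAB : ∀ i l, eA i ≠ eB l := fun i l h => by
      have h1 := hApos i
      rw [h] at h1
      exact lt_asymm h1 (hBneg l)
    rintro ⟨r, j | j⟩ ⟨r', j' | j'⟩ h
    · obtain ⟨h1, h2⟩ := add_mul_inj r.2 r'.2 (Fin.mk.inj_iff.mp (hB h))
      obtain rfl := Fin.ext h1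
      obtain rfl := Fin.ext h2
      rfl
    · exact absurd h.symm (hAB _ _)
    · exact absurd h (hAB _ _)
    · obtain ⟨h1, h2⟩ := add_mul_inj r.2 r'.2 (Fin.mk.inj_iff.mp (hA h))
      obtain rfl := Fin.ext h1
      obtain rfl := Fin.ext h2
      rfl
  have hchain : ∀ r : Fin d, ∃ w : Fin (m r) → (Fin (m r + 1) ⊕ Fin (m r)) → ℂ,
      IsotropicFamily (fun x => (ρ (g ⟨r, x⟩) : ℂ) * (1 + t (g ⟨r, x⟩) * Complex.I)) w := by
    intro r
    obtain ⟨w, hw⟩ := exists_isotropicFamily_of_interlacing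
      (a := fun j : Fin (m r) => t (eA ⟨r + j * d, (hm r j).mp j.2⟩))
      (b := fun j : Fin (m r + 1) => t (eB ⟨r + j * d, hm' r j⟩))
      (fun i => hlt _ _ rfl) (fun i => hgt _ _ (by simp; ring))
      (ρ := fun x => ρ (g ⟨r, x⟩)) (fun l => hBneg _) (fun i => hApos _)
    refine ⟨w, ?_⟩
    convert hw using 1
    funext x
    rcases x with j | j <;> rfl
  choose w hw using hchain
  have h1 := (IsotropicFamily.sigma (ζ := (fun x => (ρ x : ℂ) * (1 + t x * Complex.I)) ∘ g) hw)
  have h2 := IsotropicFamily.extend hg h1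
  have hdiv : ∀ i : Fin p, (i : ℕ) / d < m ⟨i % d, Nat.mod_lt _ hd⟩ := fun i => by
    rw [hm]
    have := Nat.mod_add_div' (i : ℕ) d
    have := i.2
    change (i : ℕ) % d + i / d * d < p
    omega
  refine ⟨_, h2.comp_injective (g := fun i : Fin p =>
    (⟨⟨i % d, Nat.mod_lt _ hd⟩, ⟨i / d, hdiv i⟩⟩ : Σ r : Fin d, Fin (m r))) ?_⟩
  intro i i' h
  have h3 : (i : ℕ) % d = i' % d := congrArg (fun x : (Σ r : Fin d, Fin (m r)) => (x.1 : ℕ)) h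
  have h4 : (i : ℕ) / d = i' / d := congrArg (fun x : (Σ r : Fin d, Fin (m r)) => (x.2 : ℕ)) h
  ext
  rw [← Nat.mod_add_div (i : ℕ) d, ← Nat.mod_add_div (i' : ℕ) d, h3, h4]

end Chains

/-! ### Counting entries in half planes -/

theorem exists_between_notMem {ι : Type*} [Finite ι] (t : ι → ℝ) {a b : ℝ} (hab : a < b) :
    ∃ τ, a < τ ∧ τ < b ∧ ∀ i, t i ≠ τ := by
  obtain ⟨τ, h1, h2⟩ := ((Set.Ioo_infinite hab).sdiff (Set.finite_range t)).nonempty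
  exact ⟨τ, h1.1, h1.2, fun i hi => h2 ⟨i, hi⟩⟩

/-- If interlacing failed at index `i`, a generic `τ` in the gap would leave at most `i + (p - 1 -
i) < p` entries in the half plane of `h1` or `h2`. -/
theorem exists_isotropicFamily_of_counts {ι : Type*} [Fintype ι] {ρ t : ι → ℝ} (hρ : ∀ i, ρ i ≠ 0)
    {p : ℕ} (hp : (Finset.univ.filter fun i => 0 < ρ i).card = p)
    (h1 : ∀ τ, (∀ i, t i ≠ τ) → p ≤ (Finset.univ.filter fun i => 0 < ρ i * (t i - τ)).card)
    (h2 : ∀ τ, (∀ i, t i ≠ τ) → p ≤ (Finset.univ.filter fun i => 0 < ρ i * (τ - t i)).card)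
    (h3 : p ≤ (Finset.univ.filter fun i => ρ i < 0).card)
    (hne : ∀ i j, 0 < ρ i → ρ j < 0 → t i ≠ t j) :
    ∃ w : Fin p → ι → ℂ, IsotropicFamily (fun x => (ρ x : ℂ) * (1 + t x * Complex.I)) w := by
  classical
  obtain ⟨eA, hA, hAmem, hAsurj, hAmono⟩ := exists_monotone_enumeration _ t hp
  obtain ⟨q, hq⟩ : ∃ q, (Finset.univ.filter fun i => ρ i < 0).card = q := ⟨_, rfl⟩
  rw [hq] at h3
  obtain ⟨eB, hB, hBmem, hBsurj, hBmono⟩ := exists_monotone_enumeration _ t hq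
  have hApos : ∀ i, 0 < ρ (eA i) := fun i => (Finset.mem_filter.mp (hAmem i)).2
  have hBneg : ∀ i, ρ (eB i) < 0 := fun i => (Finset.mem_filter.mp (hBmem i)).2
  have hsub : ∀ (f : ι → ℝ) (sA : Finset (Fin p)) (sB : Finset (Fin q)),
      (∀ i, 0 < f (eA i) → i ∈ sA) → (∀ l, f (eB l) < 0 → l ∈ sB) →
      (Finset.univ.filter fun i => 0 < ρ i * f i).card ≤ sA.card + sB.card := by
    intro f sA sB hsA hsB
    refine (Finset.card_le_card (t := sA.image eA ∪ sB.image eB) fun x hx => ?_).trans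
      ((Finset.card_union_le _ _).trans (add_le_add Finset.card_image_le Finset.card_image_le))
    have hx' := (Finset.mem_filter.mp hx).2
    rw [Finset.mem_union, Finset.mem_image, Finset.mem_image]
    rcases lt_or_gt_of_ne (hρ x) with hneg | hpos
    · obtain ⟨l, rfl⟩ := hBsurj x (by simpa using hneg)
      exact Or.inr ⟨l, hsB l ((neg_iff_neg_of_mul_pos hx').mp hneg), rfl⟩
    · obtain ⟨i, rfl⟩ := hAsurj x (by simpa using hpos)
      exact Or.inl ⟨i, hsA i ((pos_iff_pos_of_mul_pos hx').mp hpos), rfl⟩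
  have hlt : ∀ (i : Fin p) (l : Fin q), (l : ℕ) = i → t (eB l) < t (eA i) := by
    intro i l hil
    by_contra hcon
    obtain ⟨τ, hτ1, hτ2, hτ⟩ := exists_between_notMem t
      (lt_of_le_of_ne (not_lt.mp hcon) (hne _ _ (hApos i) (hBneg l)))
    have hc := (h1 τ hτ).trans (hsub (fun x => t x - τ) (Finset.Ioi i) (Finset.Iio l)
      (fun j hj => Finset.mem_Ioi.mpr (lt_of_not_ge fun hji => by
        have := hAmono hji
        simp only [Function.comp_apply] at this
        linarith))
      (fun j hj => Finset.mem_Iio.mpr (lt_of_not_ge fun hjl => by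
        have := hBmono hjl
        simp only [Function.comp_apply] at this
        linarith)))
    rw [Fin.card_Ioi, Fin.card_Iio] at hc
    have := i.2
    omega
  have hgt : ∀ (i : Fin p) (l : Fin q), (l : ℕ) = i + (q - p) → t (eA i) < t (eB l) := by
    intro i l hil
    by_contra hcon
    obtain ⟨τ, hτ1, hτ2, hτ⟩ := exists_between_notMem t
      (lt_of_le_of_ne (not_lt.mp hcon) (hne _ _ (hApos i) (hBneg l)).symm)
    have hc := (h2 τ hτ).trans (hsub (fun x => τ - t x) (Finset.Iio i) (Finset.Ioi l)
      (fun j hj => Finset.mem_Iio.mpr (lt_of_not_ge fun hji => by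
        have := hAmono hji
        simp only [Function.comp_apply] at this
        linarith))
      (fun j hj => Finset.mem_Ioi.mpr (lt_of_not_ge fun hjl => by
        have := hBmono hjl
        simp only [Function.comp_apply] at this
        linarith)))
    rw [Fin.card_Ioi, Fin.card_Iio] at hc
    have := i.2
    have := l.2
    omega
  rcases Nat.eq_zero_or_pos p with rfl | hp0
  · exact ⟨Fin.elim0, linearIndependent_empty_type, fun e => e.elim0⟩
  -- For `q = p > 0` the two interlacing relations at index `0` contradict each other.
  · refine exists_isotropicFamily_of_chains (lt_of_le_of_ne h3 fun hpq => ?_) hA hB hApos hBneg hlt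
      hgt
    have ha0 := hlt ⟨0, hp0⟩ ⟨0, by omega⟩ rfl
    have hb0 := hgt ⟨0, hp0⟩ ⟨0, by omega⟩ (by simp; omega)
    exact lt_asymm ha0 hb0

/-- The real part is `z.re - τ * z.im`. For real `z` the quotient is `0` by convention, but then no
`τ` is exceptional. -/
theorem re_mul_ne_zero_of_generic {z : ℂ} (hz : z ≠ 0) {τ : ℝ} (hτ : z.re / z.im ≠ τ) :
    ((1 + τ * Complex.I) * z).re ≠ 0 := by
  intro h
  simp [Complex.add_re] at h
  by_cases him : z.im = 0
  · refine hz (Complex.ext ?_ him)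
    rw [him] at h
    simpa using h
  · apply hτ
    field_simp
    linarith

/-- A diagonal form without antipodal entries, of which at least `k` entries lie in each open
half plane, has an isotropic family of size at least `k`. -/
theorem exists_isotropicFamily {ι : Type*} [Fintype ι] {ζ : ι → ℂ} (hζ : ∀ i, ζ i ≠ 0)
    (hanti : ∀ i j, i ≠ j → ∀ r : ℝ, 0 < r → ζ i + r * ζ j ≠ 0) {k : ℕ}
    (hk : ∀ u : ℂ, u ≠ 0 → k ≤ (Finset.univ.filter fun i => 0 < (u * ζ i).re).card) :
    ∃ (p : ℕ) (w : Fin p → ι → ℂ), k ≤ p ∧ IsotropicFamily ζ w := by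
  classical
  let count : ℂ → ℕ := fun u => (Finset.univ.filter fun i => 0 < (u * ζ i).re).card
  have hgen : {u : ℂ | ∀ i, (u * ζ i).re ≠ 0}.Nonempty := by
    obtain ⟨τ, -, -, hτ⟩ := exists_between_notMem (fun i => (ζ i).re / (ζ i).im) zero_lt_one
    exact ⟨1 + τ * Complex.I, fun i => re_mul_ne_zero_of_generic (hζ i) (hτ i)⟩
  -- Minimality over rotations that put no entry on the imaginary axis supplies all the counting
  -- bounds below.
  obtain ⟨u, hu, hmin⟩ := (measure count).wf.has_min _ hgen
  have hmin' : ∀ v : ℂ, (∀ i, (v * ζ i).re ≠ 0) → count u ≤ count v :=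
    fun v hv => not_lt.mp (hmin v hv)
  by_cases hu0 : u = 0
  · have : IsEmpty ι := ⟨fun i => hu i (by simp [hu0])⟩
    refine ⟨0, Fin.elim0, ?_, linearIndependent_empty_type, fun e => e.elim0⟩
    simpa using hk 1 one_ne_zero
  let ρ : ι → ℝ := fun i => (u * ζ i).re
  let t : ι → ℝ := fun i => (u * ζ i).im / (u * ζ i).re
  have hform : ∀ i, u * ζ i = (ρ i : ℂ) * (1 + t i * Complex.I) := by
    intro i
    have h := hu i
    apply Complex.ext
    · simp [ρ]
    · rw [Complex.im_ofReal_mul]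
      simp only [ρ, t, Complex.add_im, Complex.one_im, Complex.im_ofReal_mul,
        Complex.I_im, mul_one, zero_add]
      rw [mul_div_cancel₀ _ h]
  have hrot : ∀ (v : ℂ) (i : ι), (v * u * ζ i).re = ρ i * (v.re - v.im * t i) := by
    intro v i
    rw [mul_assoc, hform]
    simp
    ring
  have h1 : ∀ τ, (∀ i, t i ≠ τ) →
      count u ≤ (Finset.univ.filter fun i => 0 < ρ i * (t i - τ)).card := by
    intro τ hτ
    -- By `hrot` this multiplier produces the factor `t i - τ`.
    have h := hmin' ((-τ - Complex.I) * u) fun i => by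
      rw [hrot]
      refine mul_ne_zero (hu i) ?_
      simpa [sub_eq_zero, neg_add_eq_zero] using fun h => hτ i (by linarith)
    refine h.trans_eq (congrArg Finset.card (Finset.filter_congr fun i _ => ?_))
    rw [hrot]
    simp [neg_add_eq_sub]
  have h2 : ∀ τ, (∀ i, t i ≠ τ) →
      count u ≤ (Finset.univ.filter fun i => 0 < ρ i * (τ - t i)).card := by
    intro τ hτ
    have h := hmin' ((τ + Complex.I) * u) fun i => by
      rw [hrot]
      refine mul_ne_zero (hu i) ?_
      simpa [sub_eq_zero] using fun h => hτ i h.symm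
    refine h.trans_eq (congrArg Finset.card (Finset.filter_congr fun i _ => ?_))
    rw [hrot]
    simp
  have h3 : count u ≤ (Finset.univ.filter fun i => ρ i < 0).card := by
    have h := hmin' (-u) fun i => by
      rw [neg_mul, Complex.neg_re]
      exact neg_ne_zero.mpr (hu i)
    refine h.trans_eq (congrArg Finset.card (Finset.filter_congr fun i _ => ?_))
    simp [ρ]
  have h4 : ∀ i j, 0 < ρ i → ρ j < 0 → t i ≠ t j := by
    intro i j hi hj hij
    have hne : i ≠ j := fun h => by rw [h] at hi; exact lt_asymm hi hj
    refine hanti i j hne (-(ρ i / ρ j)) (neg_pos.mpr (div_neg_of_pos_of_neg hi hj)) ?_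
    have h : u * (ζ i + (-(ρ i / ρ j) : ℝ) * ζ j) = 0 := by
      rw [mul_add, mul_left_comm, hform, hform, hij]
      have : (ρ j : ℂ) ≠ 0 := by exact_mod_cast hj.ne
      push_cast
      field_simp
      ring
    exact (mul_eq_zero.mp h).resolve_left hu0
  obtain ⟨w, hw⟩ := exists_isotropicFamily_of_counts (ρ := ρ) hu rfl h1 h2 h3 h4
  refine ⟨count u, w, hk u hu0, hw.1, fun e f => ?_⟩
  have h := hw.2 e f
  simp only [← hform, mul_left_comm _ u, ← Finset.mul_sum] at h
  exact (mul_eq_zero.mp h).resolve_left hu0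

/-- If the real part of each rotation of a quadratic form is positive definite on a subspace of
dimension `k`, then the form vanishes on a subspace of dimension `k`. -/
theorem hasIsotropicSubspace_of_hasPositiveSubspaces (N : ℕ) : ∀ {E : Type*} [NormedAddCommGroup E]
    [InnerProductSpace ℂ E] [FiniteDimensional ℂ E] (T : E →ₗ[ℂ] E) (k : ℕ),
    Module.finrank ℂ E = N → HasPositiveSubspaces T k → HasIsotropicSubspace T k := by
  induction N using Nat.strong_induction_on with
  | _ N ih =>
    intro E _ _ _ T k hE hT
    rcases k with _ | k
    · exact ⟨⊥, Nat.zero_le _, fun x hx => by rw [(Submodule.mem_bot ℂ).mp hx, inner_zero_left]⟩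
    by_cases hred : ∃ x, IsReducing T x
    · obtain ⟨x, hx⟩ := hred
      obtain ⟨y, p, q, hxy, hp, hq⟩ := hx.exists_direction
      refine HasIsotropicSubspace.of_compression hx.1 hxy hp hq (ih _ ?_ _ k rfl
        (hT.compression hx.1 hxy hp hq))
      have h1 := Submodule.finrank_add_finrank_orthogonal (ℂ ∙ x)
      rw [finrank_span_singleton hx.1] at h1
      have h2 := Submodule.finrank_mono (inf_le_right : (ℂ ∙ y)ᗮ ⊓ (ℂ ∙ x)ᗮ ≤ (ℂ ∙ x)ᗮ)
      omega
    · push Not at hred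
      obtain ⟨b, ζ, hζ, hb⟩ := exists_diagonal_family N T hE hred
      obtain ⟨p, w, hkp, hw⟩ := exists_isotropicFamily hζ
        (fun i j hij r hr => ne_antipodal_of_diagonal hE hζ hb hred hij hr)
        (fun u hu => le_card_of_diagonal hE hζ hb hT hu)
      obtain ⟨U, hU, hiso⟩ := hw.hasIsotropicSubspace hζ hb
      rw [Fintype.card_fin] at hU
      exact ⟨U, hkp.trans hU, hiso⟩

/-! ### The rank-`k` numerical range -/

/-- Over `ℂ` an operator is determined by its quadratic form, so `P A P = z P` can be tested on the
range of `P`. -/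
theorem mem_rankRange_iff {n : ℕ} {A : Matrix (Fin n) (Fin n) ℂ} {k : ℕ} {z : ℂ} :
    z ∈ rankRange A k ↔ ∃ U : Submodule ℂ (EuclideanSpace ℂ (Fin n)), Module.finrank ℂ U = k ∧
      ∀ x ∈ U, inner ℂ x (A.toEuclideanLin x) = z * ‖x‖ ^ 2 := by
  let Φ := Matrix.toEuclideanCLM (n := Fin n) (𝕜 := ℂ)
  have hrank : ∀ P : Matrix (Fin n) (Fin n) ℂ, P.rank = Module.finrank ℂ (Φ P).range := fun P =>
    P.rank_eq_finrank_range_toLin (EuclideanSpace.basisFun (Fin n) ℂ).toBasis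
      (EuclideanSpace.basisFun (Fin n) ℂ).toBasis
  constructor
  · rintro ⟨P, hP, hk, h⟩
    have hp : IsStarProjection (Φ P) := hP.map Φ
    have hpA : ∀ v, Φ P (Φ A (Φ P v)) = z • Φ P v := fun v => by
      have h1 := congrArg (fun B => Φ B v) h
      simp only [map_mul, map_smul] at h1
      exact h1
    refine ⟨(Φ P).range, by rw [← hrank, hk], ?_⟩
    rintro x ⟨v, rfl⟩
    have hidem : Φ P (Φ P v) = Φ P v := congrArg (fun B => B v) hp.isIdempotentElem.eq
    have hsa : ∀ a b, inner ℂ (Φ P a) b = inner ℂ a (Φ P b) := hp.isSelfAdjoint.isSymmetric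
    change inner ℂ (Φ P v) (Φ A (Φ P v)) = z * ‖Φ P v‖ ^ 2
    have h2 : inner ℂ (Φ P v) (Φ A (Φ P v)) = inner ℂ (Φ P v) (Φ P (Φ A (Φ P v))) := by
      rw [← hsa, hidem]
    rw [h2, hpA, inner_smul_right, inner_self_eq_norm_sq_to_K]
    rfl
  · rintro ⟨U, hU, h⟩
    have hP : Φ (Φ.symm U.starProjection) = U.starProjection := Φ.apply_symm_apply _
    have hinj : Function.Injective Φ := EquivLike.injective Φ
    have hproj : IsStarProjection U.starProjection := isStarProjection_starProjection
    refine ⟨Φ.symm U.starProjection, ⟨hinj ?_, hinj ?_⟩, ?_, ?_⟩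
    · rw [map_mul, hP]
      exact hproj.isIdempotentElem
    · rw [map_star, hP]
      exact hproj.isSelfAdjoint
    · rw [hrank, hP, ← hU, Submodule.range_starProjection]
    · apply hinj
      rw [map_mul, map_mul, map_smul, hP]
      have hsa : ∀ a b, inner ℂ (U.starProjection a) b = inner ℂ a (U.starProjection b) :=
        U.starProjection_isSymmetric
      have hlin : ((U.starProjection * Φ A * U.starProjection :
            EuclideanSpace ℂ (Fin n) →L[ℂ] EuclideanSpace ℂ (Fin n)) :
          EuclideanSpace ℂ (Fin n) →ₗ[ℂ] EuclideanSpace ℂ (Fin n)) =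
          ((z • U.starProjection : EuclideanSpace ℂ (Fin n) →L[ℂ] EuclideanSpace ℂ (Fin n)) :
          EuclideanSpace ℂ (Fin n) →ₗ[ℂ] EuclideanSpace ℂ (Fin n)) := by
        rw [← ext_inner_map]
        intro v
        have hx := h (U.starProjection v) (U.starProjection_apply_mem v)
        have hidem : U.starProjection (U.starProjection v) = U.starProjection v :=
          Submodule.starProjection_eq_self_iff.mpr (U.starProjection_apply_mem v)
        change inner ℂ (U.starProjection (Φ A (U.starProjection v))) v =
          inner ℂ (z • U.starProjection v) v
        rw [hsa, inner_smul_left, ← inner_conj_symm]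
        change (starRingEnd ℂ) (inner ℂ (U.starProjection v) (A.toEuclideanLin _)) = _
        rw [hx, ← hidem, hsa, hidem, inner_self_eq_norm_sq_to_K, map_mul, map_pow,
          Complex.conj_ofReal]
        rfl
      exact ContinuousLinearMap.coe_injective hlin

theorem exists_submodule_finrank_eq {E : Type*} [AddCommGroup E] [Module ℂ E]
    (U : Submodule ℂ E) {k : ℕ} (hk : k ≤ Module.finrank ℂ U) :
    ∃ V ≤ U, Module.finrank ℂ V = k := by
  obtain ⟨f, hf⟩ := exists_linearIndependent_of_le_finrank hk
  refine ⟨Submodule.span ℂ (Set.range fun i => (f i : E)), ?_, ?_⟩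
  · rw [Submodule.span_le]
    rintro _ ⟨i, rfl⟩
    exact (f i).2
  · have h := finrank_span_eq_card (hf.map' U.subtype U.ker_subtype)
    rw [Fintype.card_fin] at h
    exact h

theorem weightedSupport_single {n : ℕ} (A : Matrix (Fin n) (Fin n) ℂ) (i : Fin n) (θ : ℝ) :
    weightedSupport A (Pi.single i 1) θ =
      sortedEigenvalue (rotatedRealPart_isHermitian A θ) i := by
  rw [weightedSupport, Finset.sum_eq_single i]
  · simp
  · intro j _ hj
    simp [hj]
  · simp

theorem rankRange_subset_weightedRange {n : ℕ} (A : Matrix (Fin n) (Fin n) ℂ) (i : Fin n) :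
    rankRange A (i + 1) ⊆ weightedRange A (Pi.single i 1) := by
  intro z hz θ
  obtain ⟨U, hU, h⟩ := mem_rankRange_iff.mp hz
  change _ ≤ weightedSupport A (Pi.single i 1) θ
  rw [weightedSupport_single, le_sortedEigenvalue_iff]
  refine ⟨U, hU.ge, fun x hx => ?_⟩
  rw [reForm_rotatedRealPart, h x hx, ← mul_assoc, ← Complex.ofReal_pow, Complex.re_mul_ofReal]

/-- The Courant–Fischer subspaces for `λ_{i+1}(H_θ(A))` are positive subspaces for the rotations of
`A - z`; an isotropic subspace of `A - z` is what membership asks for. -/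
theorem mem_rankRange_of_lt {n : ℕ} {A : Matrix (Fin n) (Fin n) ℂ} {i : Fin n} {z : ℂ}
    (h : ∀ θ : ℝ, (Complex.exp (θ * Complex.I) * z).re < weightedSupport A (Pi.single i 1) θ) :
    z ∈ rankRange A (i + 1) := by
  let T : EuclideanSpace ℂ (Fin n) →ₗ[ℂ] EuclideanSpace ℂ (Fin n) :=
    A.toEuclideanLin - z • LinearMap.id
  have hT : ∀ x, inner ℂ x (T x) = inner ℂ x (A.toEuclideanLin x) - z * ‖x‖ ^ 2 := fun x => by
    simp only [T, LinearMap.sub_apply, LinearMap.smul_apply, LinearMap.id_apply, inner_sub_right,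
      inner_smul_right, inner_self_eq_norm_sq_to_K]
    rfl
  have hpos : HasPositiveSubspaces T (i + 1) := by
    intro u hu
    obtain ⟨U, hU, hx⟩ := (le_sortedEigenvalue_iff (rotatedRealPart_isHermitian A u.arg) i _).mp
      le_rfl
    refine ⟨U, hU, fun x hxU hx0 => ?_⟩
    have h1 := hx x hxU
    have h2 := h u.arg
    rw [reForm_rotatedRealPart] at h1
    rw [weightedSupport_single] at h2
    have h3 : 0 < ‖x‖ ^ 2 := by positivity
    have h4 := mul_lt_mul_of_pos_right h2 h3
    have h5 : (u * inner ℂ x (T x)).re = ‖u‖ *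
        ((Complex.exp (u.arg * Complex.I) * inner ℂ x (A.toEuclideanLin x)).re -
          (Complex.exp (u.arg * Complex.I) * z).re * ‖x‖ ^ 2) := by
      conv_lhs => rw [← Complex.norm_mul_exp_arg_mul_I u]
      rw [mul_assoc, Complex.re_ofReal_mul, hT, mul_sub, Complex.sub_re, ← mul_assoc _ z,
        ← Complex.ofReal_pow, Complex.re_mul_ofReal]
    rw [h5]
    exact mul_pos (norm_pos_iff.mpr hu) (by linarith)
  obtain ⟨U, hU, hiso⟩ := hasIsotropicSubspace_of_hasPositiveSubspaces _ T _ rfl hpos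
  obtain ⟨V, hVU, hV⟩ := exists_submodule_finrank_eq U hU
  refine mem_rankRange_iff.mpr ⟨V, hV, fun x hx => ?_⟩
  rw [← sub_eq_zero, ← hT]
  exact hiso x (hVU hx)

/-- The range lies between the open set of strict inequalities and the closed set `W(A;e_k)`, so its
own closedness is not needed. -/
theorem exists_eq_weightedSupport_of_mem_frontier_rankRange {n : ℕ}
    {A : Matrix (Fin n) (Fin n) ℂ} {i : Fin n} {z : ℂ} (hz : z ∈ frontier (rankRange A (i + 1))) :
    z ∈ weightedRange A (Pi.single i 1) ∧ ∃ θ : ℝ,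
      (Complex.exp (θ * Complex.I) * z).re = weightedSupport A (Pi.single i 1) θ := by
  have hmem : z ∈ weightedRange A (Pi.single i 1) :=
    closure_minimal (rankRange_subset_weightedRange A i) (isClosed_weightedRange A _) hz.1
  refine ⟨hmem, ?_⟩
  by_contra! hne
  obtain ⟨ε, hε, hb⟩ := exists_ball_strict fun θ => (hmem θ).lt_of_ne (hne θ)
  exact hz.2 (mem_interior.mpr ⟨Metric.ball z ε, fun v hv => mem_rankRange_of_lt (hb v hv),
    Metric.isOpen_ball, Metric.mem_ball_self hε⟩)

/-! ### The case `c = e_k` and circular arcs -/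

theorem genericForms_single {n : ℕ} (i : Fin n) :
    genericForms (Pi.single i (1 : ℝ)) = Finset.univ.image fun l => Pi.single l (1 : ℝ) := by
  ext d
  constructor
  · intro hd
    obtain ⟨e, -, rfl⟩ := Finset.mem_image.mp hd
    refine Finset.mem_image.mpr ⟨e ⟨i, by simp⟩, Finset.mem_univ _, ?_⟩
    rw [formCoeff, Fintype.sum_eq_single ⟨i, by simp⟩]
    · simp
    · rintro ⟨l, hl⟩ hne
      refine absurd (Pi.single_eq_of_ne (fun h => hne (Subtype.ext h)) _) hl
  · intro hd
    obtain ⟨l, -, rfl⟩ := Finset.mem_image.mp hd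
    have h := comp_perm_mem_genericForms (Equiv.swap i l) (self_mem_genericForms (Pi.single i (1 : ℝ)))
    convert h using 1
    funext m
    simp [Pi.single_apply, Equiv.swap_apply_eq_iff]

theorem cPoly_single {n : ℕ} (A : Matrix (Fin n) (Fin n) ℂ) (i : Fin n) :
    cPoly A (Pi.single i 1) = A.charpoly := by
  rw [cPoly, genericForms_single, Finset.prod_image fun l _ m _ h => ?_,
    charpoly_eq_prod_eigenvalueList]
  · refine Finset.prod_congr rfl fun l _ => ?_
    rw [Finset.sum_eq_single l]
    · simp
    · intro m _ hm
      simp [hm]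
    · simp
  · by_contra hne
    have := congrFun h l
    simp [hne] at this

theorem infinite_arc (α : ℂ) {R a b : ℝ} (hR : 0 < R) (hab : a < b) :
    ((fun θ : ℝ => α + R * Complex.exp (θ * Complex.I)) '' Set.Icc a b).Infinite := by
  -- Angles are confined to an interval of length at most `1 < 2π`, where the exponential is
  -- injective.
  have hlt : a < min b (a + 1) := lt_min hab (by linarith)
  refine ((Set.Icc_infinite hlt).image fun x hx y hy h => ?_).mono
    (Set.image_mono (Set.Icc_subset_Icc_right (min_le_left _ _)))
  have hR0 : (R : ℂ) ≠ 0 := by exact_mod_cast hR.ne'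
  have h1 := mul_left_cancel₀ hR0 (add_left_cancel h)
  rw [Complex.exp_eq_exp_iff_exists_int] at h1
  obtain ⟨m, hm⟩ := h1
  have h2 : x = y + m * (2 * Real.pi) := by simpa using congrArg Complex.im hm
  have hx2 := hx.2.trans (min_le_right _ _)
  have hy2 := hy.2.trans (min_le_right _ _)
  have h3 := Real.pi_gt_three
  have h4 : (m : ℝ) < 1 := by nlinarith [hx.1, hy.1]
  have h5 : (-1 : ℝ) < m := by nlinarith [hx.1, hy.1]
  have h6 : m < 1 := by exact_mod_cast h4
  have h7 : -1 < m := by exact_mod_cast h5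
  obtain rfl : m = 0 := by omega
  simpa using h2

end WeightedNumericalRange

theorem mainTheorem4 (n : ℕ) (A : Matrix (Fin n) (Fin n) ℂ) (α : ℂ) :
    (∀ (c : Fin n → ℝ) (R : ℝ) (S : Finset ℂ), 0 < R →
      S.card = 2 * WeightedNumericalRange.cDegree A c + 1 →
      (∀ z ∈ S, z ∈ frontier (WeightedNumericalRange.weightedRange A c) ∧
        z ∈ Metric.sphere α R) →
      WeightedNumericalRange.IsCValue A c α ∧
        1 < (WeightedNumericalRange.cPoly A c).rootMultiplicity α) ∧
    (∀ (k : ℕ) (R a b : ℝ), 1 ≤ k → k ≤ n → 0 < R → a < b →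
      (∀ θ ∈ Set.Icc a b, α + R * Complex.exp (θ * Complex.I) ∈
        frontier (WeightedNumericalRange.rankRange A k)) →
      Module.End.HasEigenvalue (Matrix.toLin' A) α ∧
        1 < A.charpoly.rootMultiplicity α) := by
  open WeightedNumericalRange in
  constructor
  · intro c R S hR hS hz
    have h := one_lt_rootMultiplicity_cPoly A c α hR S (by omega) (fun z hzS => (hz z hzS).2)
      (fun z hzS => (exists_eq_weightedSupport_of_mem_frontier (hz z hzS).1).1)
      (fun z hzS => (exists_eq_weightedSupport_of_mem_frontier (hz z hzS).1).2)
    exact ⟨isCValue_of_isRoot (Polynomial.rootMultiplicity_pos'.mp (by omega)).2, h⟩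
  · intro k R a b hk1 hkn hR hab harc
    obtain ⟨i, rfl⟩ : ∃ i : Fin n, k = i + 1 := ⟨⟨k - 1, by omega⟩, by simp; omega⟩
    obtain ⟨S, hSarc, hS⟩ := (infinite_arc α hR hab).exists_subset_card_eq
      (2 * cDegree A (Pi.single i 1) + 1)
    have hfr : ∀ z ∈ S, z ∈ frontier (rankRange A (i + 1)) := fun z hz => by
      obtain ⟨θ, hθ, rfl⟩ := hSarc hz
      exact harc θ hθ
    have h := one_lt_rootMultiplicity_cPoly A (Pi.single i 1) α hR S (by omega)
      (fun z hz => by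
        obtain ⟨θ, -, rfl⟩ := hSarc hz
        simp [abs_of_pos hR])
      (fun z hz => (exists_eq_weightedSupport_of_mem_frontier_rankRange (hfr z hz)).1)
      (fun z hz => (exists_eq_weightedSupport_of_mem_frontier_rankRange (hfr z hz)).2)
    rw [cPoly_single] at h
    refine ⟨?_, h⟩
    rw [Module.End.hasEigenvalue_iff_isRoot_charpoly, Matrix.charpoly_toLin']
    exact (Polynomial.rootMultiplicity_pos'.mp (by omega)).2
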